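/- Let $V$ be a finite set. A clique of a graph $G$ on $V$ is a maximal complete vertex set. $G$ is decomposable if its cliques can be ordered $C_1,\dots,C_c$ so that for each $i\ge 2$ there is $k<i$ with $C_i\cap\bigcup_{j<i}C_j\subseteq C_k$. A junction tree of $G$ is a tree $J$ whose nodes are the cliques of $G$ such that every node on the path in $J$ between two cliques $C,D$ contains $C\cap D$. Write $G(J)$ for the graph represented by $J$ and $\mu(G)$ for the number of junction trees of $G$. Let $\pi$ be a probability distribution on the decomposable graphs on $V$ with $\pi(G)>0$ for every decomposable $G$, and put $\tilde\pi(J)=\pi(G(J))/\mu(G(J))$ for every junction tree $J$. **Proposals.** Fix $p\in(0,1)$. From a junction tree $J$, with probability $p$ try a connect move, and otherwise a disconnect move. *Connect.* If $J$ has no links, reject. Otherwise choose a link of $J$ uniformly, with ends $C_X,C_Y$, and let $S=C_X\cap C_Y$. Choose independently non-empty $X\subseteq C_X\setminus S$ and $Y\subseteq C_Y\setminus S$: in the single-edge version uniformly chosen singletons; in the multiple-edge version the size of $X$ is uniform on $\{1,\dots,|C_X\setminus S|\}$ and $X$ is uniform among the subsets of that size, and similarly for $Y$. The proposal $J'$ is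 as follows. (a) If $C_X=X\cup S$ and $C_Y=Y\cup S$, merge $C_X$ and $C_Y$ into the single node $X\cup Y\cup S$, linked to all the other neighbours of $C_X$ and of $C_Y$. (b) If $C_X\supsetneq X\cup S$ and $C_Y=Y\cup S$, replace $C_Y$ by $X\cup Y\cup S$, keeping all links. (c) If $C_X=X\cup S$ and $C_Y\supsetneq Y\cup S$, replace $C_X$ by $X\cup Y\cup S$, keeping all links. (d) If both inclusions are strict, replace the link $C_X - C_Y$ by the path $C_X - (X\cup Y\cup S) - C_Y$ through a new node. *Disconnect.* Choose a clique $C$ of $J$ uniformly; if $|C|\le 1$, reject. Partition $C$ at random into $X,Y,S$ with $X,Y$ non-empty: in the single-edge version $X=\{x\}$ and $Y=\{y\}$ are drawn uniformly without replacement; in the multiple-edge version $M$ is uniform on $\{2,\dots,|C|\}$, then $N$ is uniform on $\{1,\dots,M-1\}$, and the partition is uniform among those with $|X|=N$, $|Y|=M-N$. If a neighbour of $C$ in $J$ meets both $X$ and $Y$, reject. Otherwise let $\mathcal N$, $\mathcal N_X$, $\mathcal N_Y$ be the sets of neighbours of $C$ that meet neither $X$ nor $Y$, only $X$, and only $Y$,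 respectively. (a) If no member of $\mathcal N_X$ contains $X\cup S$ and no member of $\mathcal N_Y$ contains $Y\cup S$, replace $C$ by two linked nodes $X\cup S$ and $Y\cup S$, link $\mathcal N_X$ to the first and $\mathcal N_Y$ to the second, and link each member of $\mathcal N$ to one of the two, by independent fair coins. (b) If some member of $\mathcal N_X$ contains $X\cup S$ but no member of $\mathcal N_Y$ contains $Y\cup S$, then replace $C$ by $Y\cup S$, keeping all links, if $|\mathcal N_X|=1$, and reject otherwise. (c) The same with $X$ and $Y$ exchanged. (d) If both exist, then, if $\mathcal N=\emptyset$ and $|\mathcal N_X|=|\mathcal N_Y|=1$, delete $C$ and link its two neighbours, and reject otherwise. Let $q(J,J')$ be the probability that $J'$ is proposed from $J$. A proposed $J'$ is accepted with probability $$\alpha(J,J')=\min\Big\{1,\frac{\tilde\pi(J')q(J',J)}{\tilde\pi(J)q(J,J')}\Big\}\quad\text{or, in the factorised variant,}\quad\tilde\alpha(J,J')=\min\Big\{1,\frac{\tilde\pi(J')}{\tilde\pi(J)}\Big\}\min\Big\{1,\frac{q(J',J)}{q(J,J')}\Big\},$$ and otherwise the chain stays at $J$. **Claim.** For the single-edge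 and for the multiple-edge version, and for both acceptance probabilities: 1. $\tilde\pi$ is a strictly positive probability distribution on the finite set of junction trees on $V$. 2. The sampler is a Markov chain on junction trees whose transition matrix $P$ is stochastic and reversible with respect to $\tilde\pi$: $\tilde\pi(J)P(J,J')=\tilde\pi(J')P(J',J)$ for all $J,J'$. In particular $\tilde\pi P=\tilde\pi$. 3. $P$ is irreducible. 4. The chain is ergodic: $P^n(J,J')\to\tilde\pi(J')$ as $n\to\infty$ for all $J,J'$, and for every initial distribution and every real function $f$ on junction trees, $\frac1n\sum_{k<n}f(J_k)\to\sum_J\tilde\pi(J)f(J)$ almost surely. -/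

import Mathlib

namespace JTSampler

/-! ### Decomposable graphs and junction trees -/

section Graphs

/-- `C` is a clique of `G`: a complete set of vertices, maximal among the complete sets. -/
def IsMaxClique {V : Type*} (G : SimpleGraph V) (C : Finset V) : Prop :=
  Maximal (fun D : Finset V => G.IsClique (D : Set V)) C

/-- `G` is decomposable: its cliques can be enumerated, without repetition, as `C 0, C 1, …` with
the running intersection property. -/
def IsDecomposable {V : Type*} [DecidableEq V] (G : SimpleGraph V) : Prop :=
  ∃ (c : ℕ) (C : Fin c → Finset V), Function.Injective C ∧
    (∀ D : Finset V, IsMaxClique G D ↔ ∃ i, C i = D) ∧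
    ∀ i : Fin c, 0 < (i : ℕ) →
      ∃ k : Fin c, k < i ∧ C i ∩ (Finset.univ.filter (fun j => j < i)).biUnion C ⊆ C k

/-- A finite collection of vertex sets (the nodes) with links between vertex sets. No condition is
imposed here; see `CliqueTree.IsJunctionTreeOf`. -/
@[ext]
structure CliqueTree (V : Type*) where
  /-- the nodes -/
  nodes : Finset (Finset V)
  /-- the links -/
  links : SimpleGraph (Finset V)

namespace CliqueTree

/-- The graph represented by `T`: two distinct vertices are joined by an edge if and only if some
node contains both. -/
def graph {V : Type*} (T : CliqueTree V) : SimpleGraph V where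
  Adj x y := x ≠ y ∧ ∃ C ∈ T.nodes, x ∈ C ∧ y ∈ C
  symm := ⟨fun _ _ h => ⟨h.1.symm, h.2.imp fun _ hC => ⟨hC.1, hC.2.2, hC.2.1⟩⟩⟩
  loopless := ⟨fun _ h => h.1 rfl⟩

/-- `T` is a junction tree of `G`: its nodes are the cliques of `G`, its links form a tree on the
nodes, and every node on the path between two nodes `C` and `D` contains `C ∩ D`. -/
structure IsJunctionTreeOf {V : Type*} [DecidableEq V] (T : CliqueTree V) (G : SimpleGraph V) :
    Prop where
  mem_nodes_iff : ∀ C, C ∈ T.nodes ↔ IsMaxClique G C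
  mem_of_link : ∀ C D, T.links.Adj C D → C ∈ T.nodes ∧ D ∈ T.nodes
  isTree : (T.links.induce (T.nodes : Set (Finset V))).IsTree
  junction : ∀ C ∈ T.nodes, ∀ D ∈ T.nodes, ∀ p : T.links.Walk C D, p.IsPath →
    ∀ E ∈ p.support, C ∩ D ⊆ E

end CliqueTree

/-- The state space: all junction trees on the vertex set `V`. -/
@[ext]
structure JunctionTree (V : Type*) [DecidableEq V] where
  /-- the underlying nodes and links -/
  tree : CliqueTree V
  /-- it is a junction tree of the graph that it represents -/
  isJunctionTree : tree.IsJunctionTreeOf tree.graph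

instance instFiniteCliqueTree {V : Type*} [Finite V] : Finite (CliqueTree V) :=
  Finite.of_injective (fun T : CliqueTree V => (T.nodes, T.links)) fun _ _ h =>
    CliqueTree.ext (congrArg Prod.fst h) (congrArg Prod.snd h)

instance instFiniteJunctionTree {V : Type*} [DecidableEq V] [Finite V] :
    Finite (JunctionTree V) :=
  Finite.of_injective (fun J : JunctionTree V => J.tree) fun _ _ h => JunctionTree.ext h

noncomputable instance instFintypeJunctionTree {V : Type*} [DecidableEq V] [Finite V] :
    Fintype (JunctionTree V) :=
  Fintype.ofFinite _

noncomputable instance instDecidableEqJunctionTree {V : Type*} [DecidableEq V] :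
    DecidableEq (JunctionTree V) :=
  Classical.decEq _

/-- `μ(G)`: the number of junction trees of `G`. -/
noncomputable def numJunctionTrees {V : Type*} [DecidableEq V] (G : SimpleGraph V) : ℕ :=
  Nat.card {T : CliqueTree V // T.IsJunctionTreeOf G}

/-- The target distribution `π(G(J)) / μ(G(J))` on junction trees. -/
noncomputable def target {V : Type*} [DecidableEq V] (π : SimpleGraph V → ℝ)
    (J : JunctionTree V) : ℝ :=
  π J.tree.graph / (numJunctionTrees J.tree.graph : ℝ)

end Graphs

/-! ### The connect and disconnect moves -/

section Moves

/-- Replace every node `C` by `f C`, moving the links along. -/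
def CliqueTree.relabel {V : Type*} [DecidableEq V] (T : CliqueTree V)
    (f : Finset V → Finset V) : CliqueTree V where
  nodes := T.nodes.image f
  links := SimpleGraph.fromRel fun A B => ∃ C D, T.links.Adj C D ∧ f C = A ∧ f D = B

/-- The result of the connect move which, at a link between the nodes `CX` and `CY` with separator
`S = CX ∩ CY`, completely connects `X ⊆ CX \ S` and `Y ⊆ CY \ S`. -/
def CliqueTree.connect {V : Type*} [DecidableEq V] (T : CliqueTree V)
    (CX CY X Y : Finset V) : CliqueTree V :=
  let S := CX ∩ CY
  let U := X ∪ Y ∪ S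
  if CX = X ∪ S then
    if CY = Y ∪ S then
      T.relabel fun Z => if Z = CX ∨ Z = CY then U else Z
    else
      T.relabel fun Z => if Z = CX then U else Z
  else
    if CY = Y ∪ S then
      T.relabel fun Z => if Z = CY then U else Z
    else
      { nodes := insert U T.nodes
        links := T.links.deleteEdges {s(CX, CY)} ⊔
          (SimpleGraph.edge CX U ⊔ SimpleGraph.edge U CY) }

open Classical in
/-- The nodes linked to `C`. -/
noncomputable def CliqueTree.nbrs {V : Type*} (T : CliqueTree V) (C : Finset V) :
    Finset (Finset V) :=
  T.nodes.filter fun D => T.links.Adj C D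

/-- The neighbours of `C` that intersect `X`. -/
noncomputable def CliqueTree.nbrsMeeting {V : Type*} [DecidableEq V] (T : CliqueTree V)
    (C X : Finset V) : Finset (Finset V) :=
  (T.nbrs C).filter fun D => (D ∩ X).Nonempty

/-- The neighbours of `C` that intersect neither `X` nor `Y`. -/
noncomputable def CliqueTree.nbrsAvoiding {V : Type*} [DecidableEq V] (T : CliqueTree V)
    (C X Y : Finset V) : Finset (Finset V) :=
  (T.nbrs C).filter fun D => ¬ (D ∩ X).Nonempty ∧ ¬ (D ∩ Y).Nonempty

open Classical in
/-- The result of the disconnect move at the node `C = X ∪ Y ∪ S` (a disjoint union), or `none` if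
the proposal is rejected. The set `A` consists of those neighbours of `C` intersecting neither `X`
nor `Y` which, when `C` is split into `X ∪ S` and `Y ∪ S`, are linked to `X ∪ S`; the other
neighbours of this kind are then linked to `Y ∪ S`. -/
noncomputable def CliqueTree.disconnect {V : Type*} [DecidableEq V] (T : CliqueTree V)
    (C X Y : Finset V) (A : Finset (Finset V)) : Option (CliqueTree V) :=
  let S := C \ (X ∪ Y)
  let NX := T.nbrsMeeting C X
  let NY := T.nbrsMeeting C Y
  let N := T.nbrsAvoiding C X Y
  if (NX ∩ NY).Nonempty then none
  else if ∃ D ∈ NX, X ∪ S ⊆ D then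
    if ∃ D ∈ NY, Y ∪ S ⊆ D then
      if N = ∅ ∧ NX.card = 1 ∧ NY.card = 1 then
        some
          { nodes := T.nodes.erase C
            links := SimpleGraph.fromRel fun D E =>
              (T.links.Adj D E ∧ D ≠ C ∧ E ≠ C) ∨ (D ∈ NX ∧ E ∈ NY) }
      else none
    else
      if NX.card = 1 then some (T.relabel fun Z => if Z = C then Y ∪ S else Z) else none
  else
    if ∃ D ∈ NY, Y ∪ S ⊆ D then
      if NY.card = 1 then some (T.relabel fun Z => if Z = C then X ∪ S else Z) else none
    else
      some
        { nodes := insert (X ∪ S) (insert (Y ∪ S) (T.nodes.erase C))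
          links := SimpleGraph.fromRel fun D E =>
            (T.links.Adj D E ∧ D ≠ C ∧ E ≠ C) ∨ (D = X ∪ S ∧ E = Y ∪ S) ∨
            (D = X ∪ S ∧ E ∈ NX ∪ A) ∨ (D = Y ∪ S ∧ E ∈ NY ∪ (N \ A)) }

end Moves

/-! ### The proposal probabilities -/

section Proposal

/-- The two versions of the moves: `X` and `Y` singletons, or arbitrary non-empty sets. -/
inductive MoveType where
  | single
  | multiple

/-- The probability that `X` is selected from the set `B`. For single-edge moves `X` is a uniformly
chosen singleton; for multiple-edge moves the size of `X` is uniform on `1, …, |B|`, and `X` is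
then uniform among the subsets of `B` of that size. -/
noncomputable def connectLaw {V : Type*} (m : MoveType) (B X : Finset V) : ℝ :=
  match m with
  | .single => if X.card = 1 then 1 / (B.card : ℝ) else 0
  | .multiple => if X.Nonempty then 1 / (B.card : ℝ) * (1 / (B.card.choose X.card : ℝ)) else 0

open Nat in
/-- The probability that `(X, Y)` is the ordered pair selected from the clique `C`, where `X`, `Y`
are disjoint subsets of `C`. For single-edge moves the two elements are drawn uniformly without
replacement; for multiple-edge moves `M = |X ∪ Y|` is uniform on `2, …, |C|`, then `|X|` is uniform
on `1, …, M - 1`, and then the partition is uniform among those with these sizes. -/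
noncomputable def disconnectLaw {V : Type*} (m : MoveType) (C X Y : Finset V) : ℝ :=
  match m with
  | .single =>
      if X.card = 1 ∧ Y.card = 1 then 1 / ((C.card : ℝ) * ((C.card : ℝ) - 1)) else 0
  | .multiple =>
      if X.Nonempty ∧ Y.Nonempty then
        1 / ((C.card : ℝ) - 1) * (1 / ((X.card : ℝ) + (Y.card : ℝ) - 1)) *
          ((X.card ! : ℝ) * (Y.card ! : ℝ) * ((C.card - (X.card + Y.card)) ! : ℝ) /
            (C.card ! : ℝ))
      else 0

open Classical in
/-- The links of `T`, each with both of its orientations. -/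
noncomputable def CliqueTree.orientedLinks {V : Type*} (T : CliqueTree V) :
    Finset (Finset V × Finset V) :=
  (T.nodes ×ˢ T.nodes).filter fun e => T.links.Adj e.1 e.2

open Classical in
/-- The probability that the connect move from `J` proposes `K`: a uniformly chosen link (its ends
named `CX`, `CY` in random order), then independent choices of `X ⊆ CX \ S` and `Y ⊆ CY \ S`, where
`S = CX ∩ CY`. If there are no links, nothing is proposed. -/
noncomputable def connectProb {V : Type*} [DecidableEq V] (m : MoveType)
    (J K : JunctionTree V) : ℝ :=
  ∑ e ∈ J.tree.orientedLinks, 1 / (J.tree.orientedLinks.card : ℝ) *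
    ∑ X ∈ (e.1 \ e.2).powerset, ∑ Y ∈ (e.2 \ e.1).powerset,
      connectLaw m (e.1 \ e.2) X * connectLaw m (e.2 \ e.1) Y *
        if J.tree.connect e.1 e.2 X Y = K.tree then 1 else 0

open Classical in
/-- The probability that the disconnect move from `J` proposes `K`: a uniformly chosen clique `C`,
then a random partition of `C` into `X`, `Y` and `S`, and then a fair coin for each neighbour of
`C` intersecting neither `X` nor `Y`. -/
noncomputable def disconnectProb {V : Type*} [DecidableEq V] (m : MoveType)
    (J K : JunctionTree V) : ℝ :=
  ∑ C ∈ J.tree.nodes, 1 / (J.tree.nodes.card : ℝ) *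
    ∑ X ∈ C.powerset, ∑ Y ∈ (C \ X).powerset, disconnectLaw m C X Y *
      ∑ A ∈ (J.tree.nbrsAvoiding C X Y).powerset,
        (1 / 2 : ℝ) ^ (J.tree.nbrsAvoiding C X Y).card *
          if J.tree.disconnect C X Y A = some K.tree then 1 else 0

/-- The proposal probability `q(J, K)` when the connect move is tried with probability `p` and the
disconnect move with probability `1 - p`. -/
noncomputable def proposal {V : Type*} [DecidableEq V] (m : MoveType) (p : ℝ)
    (J K : JunctionTree V) : ℝ :=
  p * connectProb m J K + (1 - p) * disconnectProb m J K

end Proposal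

/-! ### The Markov chain -/

section Chain

/-- The two versions of the acceptance probability. -/
inductive AcceptRule where
  | standard
  | factorised

/-- The probability that a move proposed from `J` to `K` is accepted, for the target `w` and the
proposal probabilities `q`. -/
noncomputable def acceptProb {S : Type*} (a : AcceptRule) (w : S → ℝ) (q : S → S → ℝ)
    (J K : S) : ℝ :=
  match a with
  | .standard => min 1 (w K * q K J / (w J * q J K))
  | .factorised => min 1 (w K / w J) * min 1 (q K J / q J K)

/-- The transition matrix: from `J` propose `K` with probability `q J K`, move there if it is
accepted, and stay at `J` in all other cases. -/
noncomputable def transition {S : Type*} [Fintype S] [DecidableEq S] (a : AcceptRule)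
    (w : S → ℝ) (q : S → S → ℝ) : Matrix S S ℝ :=
  Matrix.of fun J K =>
    if K = J then 1 - ∑ L ∈ Finset.univ.erase J, q J L * acceptProb a w q J L
    else q J K * acceptProb a w q J K

/-- The transition matrix of the junction tree sampler. -/
noncomputable def samplerMatrix {V : Type*} [Fintype V] [DecidableEq V] (m : MoveType)
    (a : AcceptRule) (p : ℝ) (π : SimpleGraph V → ℝ) :
    Matrix (JunctionTree V) (JunctionTree V) ℝ :=
  transition a (target π) (proposal m p)

/-- `Z` is a Markov chain with transition matrix `P` (and any initial distribution) under `ℙ`. -/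
def IsMarkovChain {S Ω : Type*} [MeasurableSpace Ω] (P : Matrix S S ℝ)
    (ℙ : MeasureTheory.Measure Ω) (Z : ℕ → Ω → S) : Prop :=
  (∀ n s, MeasurableSet (Z n ⁻¹' {s})) ∧
    ∀ (n : ℕ) (s : ℕ → S), ℙ.real {ω | ∀ k ≤ n + 1, Z k ω = s k} =
      ℙ.real {ω | ∀ k ≤ n, Z k ω = s k} * P (s n) (s (n + 1))

end Chain

end JTSampler

namespace JTSampler

/-! ### Metropolis–Hastings transition matrices -/

section Transition

variable {S : Type*} {a : AcceptRule} {w : S → ℝ} {q : S → S → ℝ}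

/-! Reversibility is the Metropolis–Hastings identity: for both acceptance rules the flow from `J`
to `K` is symmetric in `J` and `K` (`mul_acceptProb_symm`). It only needs a positive target and
nonnegative proposals; row sums at most 1 then suffice for stochasticity, as missing mass counts as
rejection. The target has total mass 1 because the fibre of `J ↦ G(J)` over `G` has `μ(G)` elements,
and `μ(G) > 0` exactly when `G` is decomposable: peeling leaves off a junction tree gives an
ordering with running intersection, and such an ordering attaches the cliques as leaves one by one.

Irreducibility is a climbing argument (`exists_connect`). At any link of a junction tree a
single-edge connect move adds an edge to the graph, and some disconnect move with positive
probability undoes it. Both versions of the sampler give singletons positive probability, so both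
allow this step in both directions. As the graph strictly grows, the climb ends at a tree without
links, and there is only one, with the whole vertex set as its node. All states thus communicate
through this hub, where every attempted connect move is rejected; the hub has a loop and the matrix
is primitive.

To check that a connect move yields a junction tree, `IsIntersectionTree` replaces paths by two
conditions that are easy to follow under changes of the tree: the nodes containing a given vertex
are connected, and there are fewer links than nodes. The Helly property (`exists_subset`) then shows
that the nodes are the cliques as soon as no node contains a linked one.

For a primitive stochastic matrix, Doeblin's estimate gives convergence of the powers. The averages
of `f` are handled through the Poisson equation `h - P h = f - l`, where `l` is the target mean of
`f`: the sums of `f - l` are a martingale with bounded increments up to a bounded error, so a second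
moment bound gives convergence along squares, and monotonicity fills the gaps. -/

theorem acceptProb_nonneg (hw : ∀ J, 0 < w J) (hq : ∀ J K, 0 ≤ q J K) (J K : S) :
    0 ≤ acceptProb a w q J K := by
  have := hq J K; have := hq K J; have := hw J; have := hw K
  cases a <;> simp only [acceptProb] <;> positivity

theorem acceptProb_le_one (hw : ∀ J, 0 < w J) (hq : ∀ J K, 0 ≤ q J K) (J K : S) :
    acceptProb a w q J K ≤ 1 := by
  have := hq J K; have := hq K J; have := hw J; have := hw K
  cases a
  · exact min_le_left _ _
  · exact mul_le_one₀ (min_le_left _ _) (by positivity) (min_le_left _ _)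

theorem acceptProb_pos (hw : ∀ J, 0 < w J) {J K : S} (h : 0 < q J K) (h' : 0 < q K J) :
    0 < acceptProb a w q J K := by
  have := hw J; have := hw K
  cases a <;> simp only [acceptProb] <;> positivity

/-- This is what makes the flow symmetric. At `x = 0` the convention `y / 0 = 0` is harmless, since
both sides vanish. -/
theorem mul_min_one_div {x y : ℝ} (hx : 0 ≤ x) (hy : 0 ≤ y) : x * min 1 (y / x) = min x y := by
  rcases hx.eq_or_lt with rfl | hx
  · simp [hy]
  · rw [mul_min_of_nonneg _ _ hx.le, mul_one, mul_div_cancel₀ _ hx.ne']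

/-- In the factorised rule the target part and the proposal part of the flow are symmetric
separately. -/
theorem mul_acceptProb_symm (hw : ∀ J, 0 < w J) (hq : ∀ J K, 0 ≤ q J K) (J K : S) :
    w J * (q J K * acceptProb a w q J K) = w K * (q K J * acceptProb a w q K J) := by
  have hJ := (hw J).le
  have hK := (hw K).le
  cases a
  · simp only [acceptProb]
    rw [← mul_assoc, ← mul_assoc, mul_min_one_div (mul_nonneg hJ (hq J K)) (mul_nonneg hK (hq K J)),
      mul_min_one_div (mul_nonneg hK (hq K J)) (mul_nonneg hJ (hq J K)), min_comm]
  · simp only [acceptProb]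
    calc _ = (w J * min 1 (w K / w J)) * (q J K * min 1 (q K J / q J K)) := by ring
      _ = (w K * min 1 (w J / w K)) * (q K J * min 1 (q J K / q K J)) := by
        rw [mul_min_one_div hJ hK, mul_min_one_div hK hJ, mul_min_one_div (hq J K) (hq K J),
          mul_min_one_div (hq K J) (hq J K), min_comm, min_comm (q J K)]
      _ = _ := by ring

variable [Fintype S] [DecidableEq S]

/-- A deficit in a row sum of `q` is the probability that nothing is proposed; it ends up in the
diagonal entry. -/
theorem transition_mem_rowStochastic (hw : ∀ J, 0 < w J) (hq : ∀ J K, 0 ≤ q J K)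
    (hq1 : ∀ J, ∑ K, q J K ≤ 1) : transition a w q ∈ Matrix.rowStochastic ℝ S := by
  rw [Matrix.mem_rowStochastic_iff_sum]
  refine ⟨fun J K => ?_, fun J => ?_⟩
  · simp only [transition, Matrix.of_apply]
    split_ifs with h
    · rw [sub_nonneg]
      calc ∑ L ∈ Finset.univ.erase J, q J L * acceptProb a w q J L
          ≤ ∑ L ∈ Finset.univ.erase J, q J L := Finset.sum_le_sum fun L _ =>
            mul_le_of_le_one_right (hq J L) (acceptProb_le_one hw hq J L)
        _ ≤ ∑ L, q J L := Finset.sum_le_sum_of_subset_of_nonneg (Finset.erase_subset _ _)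
            fun L _ _ => hq J L
        _ ≤ 1 := hq1 J
    · exact mul_nonneg (hq J K) (acceptProb_nonneg hw hq J K)
  · rw [← Finset.add_sum_erase _ _ (Finset.mem_univ J)]
    simp only [transition, Matrix.of_apply, if_true]
    rw [Finset.sum_congr rfl fun K hK => if_neg (Finset.ne_of_mem_erase hK)]
    ring

theorem transition_reversible (hw : ∀ J, 0 < w J) (hq : ∀ J K, 0 ≤ q J K) (J K : S) :
    w J * transition a w q J K = w K * transition a w q K J := by
  simp only [transition, Matrix.of_apply]
  by_cases h : K = J
  · subst h; rfl
  · rw [if_neg h, if_neg (Ne.symm h), mul_acceptProb_symm hw hq]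

theorem vecMul_eq_of_reversible {P : Matrix S S ℝ} (hP : P ∈ Matrix.rowStochastic ℝ S)
    (h : ∀ J K, w J * P J K = w K * P K J) : Matrix.vecMul w P = w := by
  ext K
  simp only [Matrix.vecMul, dotProduct, h _ K, ← Finset.mul_sum,
    Matrix.sum_row_of_mem_rowStochastic hP, mul_one]

theorem transition_pos (hw : ∀ J, 0 < w J) {J K : S} (hne : K ≠ J) (h : 0 < q J K)
    (h' : 0 < q K J) : 0 < transition a w q J K := by
  simp only [transition, Matrix.of_apply, if_neg hne]
  exact mul_pos h (acceptProb_pos hw h h')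

theorem transition_self_pos (hw : ∀ J, 0 < w J) (hq : ∀ J K, 0 ≤ q J K) {J : S}
    (h : ∑ K, q J K < 1) : 0 < transition a w q J J := by
  simp only [transition, Matrix.of_apply, if_true]
  rw [sub_pos]
  calc ∑ L ∈ Finset.univ.erase J, q J L * acceptProb a w q J L
      ≤ ∑ L ∈ Finset.univ.erase J, q J L := Finset.sum_le_sum fun L _ =>
        mul_le_of_le_one_right (hq J L) (acceptProb_le_one hw hq J L)
    _ ≤ ∑ L, q J L := Finset.sum_le_sum_of_subset_of_nonneg (Finset.erase_subset _ _)
        fun L _ _ => hq J L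
    _ < 1 := h

end Transition

/-! ### Finite Markov chains: convergence to equilibrium -/

section Convergence

/-- The matrix all of whose rows are `w`. -/
def constRows {S : Type*} (w : S → ℝ) : Matrix S S ℝ := Matrix.of fun _ j => w j

theorem mul_constRows {S : Type*} [Fintype S] {Q : Matrix S S ℝ} (hQ : ∀ i, ∑ j, Q i j = 1) (w : S → ℝ) :
    Q * constRows w = constRows w := by
  ext i j
  simp [Matrix.mul_apply, constRows, ← Finset.sum_mul, hQ i]

theorem constRows_mul {S : Type*} [Fintype S] {Q : Matrix S S ℝ} {w : S → ℝ} (hQ : Matrix.vecMul w Q = w) :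
    constRows w * Q = constRows w := by
  ext i j
  simpa [Matrix.mul_apply, constRows, Matrix.vecMul, dotProduct] using congrFun hQ j

variable {S : Type*} [Fintype S] [DecidableEq S] {P : Matrix S S ℝ}

theorem pow_add_apply_pos (hP : ∀ i j, 0 ≤ P i j) {k l : ℕ} {i j m : S} (h : 0 < (P ^ k) i j)
    (h' : 0 < (P ^ l) j m) : 0 < (P ^ (k + l)) i m := by
  rw [pow_add, Matrix.mul_apply]
  exact (mul_pos h h').trans_le (Finset.single_le_sum (f := fun j => (P ^ k) i j * (P ^ l) j m)
    (fun x _ => mul_nonneg (Matrix.pow_apply_nonneg hP k i x) (Matrix.pow_apply_nonneg hP l x m))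
    (Finset.mem_univ j))

theorem exists_pow_pos_of_reflTransGen (hP : ∀ i j, 0 ≤ P i j) {i j : S}
    (h : Relation.ReflTransGen (fun i j => 0 < P i j) i j) : ∃ k, 0 < (P ^ k) i j := by
  induction h with
  | refl => exact ⟨0, by simp⟩
  | tail _ hbc ih =>
    obtain ⟨k, hk⟩ := ih
    exact ⟨k + 1, pow_add_apply_pos hP hk (by simpa using hbc)⟩

/-- A nonnegative matrix all of whose states communicate with one state that has a loop is
primitive. -/
theorem isPrimitive_of_communicating (hP : ∀ i j, 0 ≤ P i j) (z : S) (hz : 0 < P z z)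
    (hto : ∀ i, Relation.ReflTransGen (fun i j => 0 < P i j) i z)
    (hfrom : ∀ i, Relation.ReflTransGen (fun i j => 0 < P i j) z i) : P.IsPrimitive := by
  choose k hk using fun i => exists_pow_pos_of_reflTransGen hP (hto i)
  choose l hl using fun i => exists_pow_pos_of_reflTransGen hP (hfrom i)
  refine ⟨hP, Finset.univ.sup k + Finset.univ.sup l + 1, by omega, fun i j => ?_⟩
  have hki : k i ≤ Finset.univ.sup k := Finset.le_sup (Finset.mem_univ i)
  have hlj : l j ≤ Finset.univ.sup l := Finset.le_sup (Finset.mem_univ j)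
  have hloop : ∀ m, 0 < (P ^ m) z z := fun m => by
    induction m with
    | zero => simp
    | succ m ih => exact pow_add_apply_pos hP ih (by simpa using hz)
  have := pow_add_apply_pos hP (pow_add_apply_pos hP (hk i)
    (hloop (Finset.univ.sup k + Finset.univ.sup l + 1 - k i - l j))) (hl j)
  rwa [show k i + (Finset.univ.sup k + Finset.univ.sup l + 1 - k i - l j) + l j =
    Finset.univ.sup k + Finset.univ.sup l + 1 by omega] at this

theorem vecMul_pow_eq {w : S → ℝ} (h : Matrix.vecMul w P = w) (n : ℕ) :
    Matrix.vecMul w (P ^ n) = w := by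
  induction n with
  | zero => simp
  | succ n ih => rw [pow_succ, ← Matrix.vecMul_vecMul, ih, h]

/-- Doeblin's estimate. -/
theorem abs_pow_mul_sub_le {w : S → ℝ} (hw0 : ∀ i, 0 ≤ w i) (hw1 : ∑ i, w i = 1)
    {Q : Matrix S S ℝ} (hQ : Q ∈ Matrix.rowStochastic ℝ S) (hst : Matrix.vecMul w Q = w)
    {δ : ℝ} (hδ1 : δ < 1) (hδ : ∀ i j, δ * w j ≤ Q i j) (n : ℕ) (i j : S) :
    |(Q ^ n) i j - w j| ≤ (1 - δ) ^ n := by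
  have hpos : 0 < 1 - δ := by linarith
  -- `Q` is a mixture: with weight `δ` jump to the law `w`, with weight `1 - δ` follow the
  -- stochastic matrix `R`.
  set R : Matrix S S ℝ := (1 - δ)⁻¹ • (Q - δ • constRows w) with hR
  have hQR : Q = (1 - δ) • R + δ • constRows w := by
    rw [hR, smul_smul, mul_inv_cancel₀ hpos.ne', one_smul, sub_add_cancel]
  have hRs : R ∈ Matrix.rowStochastic ℝ S := by
    rw [Matrix.mem_rowStochastic_iff_sum]
    refine ⟨fun i j => ?_, fun i => ?_⟩
    · simp only [hR, Matrix.smul_apply, Matrix.sub_apply, constRows, Matrix.of_apply, smul_eq_mul]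
      exact mul_nonneg (inv_nonneg.2 hpos.le) (sub_nonneg.2 (hδ i j))
    · simp only [hR, Matrix.smul_apply, Matrix.sub_apply, constRows, Matrix.of_apply, smul_eq_mul,
        ← Finset.mul_sum, Finset.sum_sub_distrib, hw1, Matrix.sum_row_of_mem_rowStochastic hQ]
      field_simp
  have hRw : Matrix.vecMul w R = w := by
    have h1 : Matrix.vecMul w (constRows w) = w := by
      ext j; simp [Matrix.vecMul, dotProduct, constRows, ← Finset.sum_mul, hw1]
    rw [hR, Matrix.vecMul_smul, Matrix.vecMul_sub, Matrix.vecMul_smul, hst, h1]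
    ext j
    simp only [Pi.smul_apply, Pi.sub_apply, smul_eq_mul]
    field_simp
  clear_value R
  -- `constRows w` absorbs `Q`, `R` and itself, so only the term in which `R` is used at every step
  -- survives in the difference.
  have key : ∀ n : ℕ, Q ^ n - constRows w = (1 - δ) ^ n • (R ^ n - constRows w) := by
    intro n
    induction n with
    | zero => simp
    | succ n ih =>
      have e1 : Q ^ n = (1 - δ) ^ n • (R ^ n - constRows w) + constRows w := by
        rw [← ih, sub_add_cancel]
      have e2 : constRows w * Q = constRows w := constRows_mul hst
      have e3 : R ^ n * constRows w = constRows w :=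
        mul_constRows (fun i => Matrix.sum_row_of_mem_rowStochastic (pow_mem hRs n) i) w
      have e4 : constRows w * R = constRows w := constRows_mul hRw
      have e5 : constRows w * constRows w = constRows w := mul_constRows (fun _ => hw1) w
      rw [pow_succ, e1, add_mul, e2, add_sub_cancel_right]
      conv_lhs => rw [hQR]
      rw [smul_mul_assoc, sub_mul, mul_add, mul_add, mul_smul_comm, mul_smul_comm, mul_smul_comm,
        mul_smul_comm, ← pow_succ, e3, e4, e5, pow_succ (1 - δ), mul_smul, smul_sub (1 - δ)]
      congr 1
      abel
  have h := congrFun (congrFun (key n) i) j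
  simp only [Matrix.sub_apply, Matrix.smul_apply, smul_eq_mul, constRows, Matrix.of_apply] at h
  rw [h, abs_mul, abs_of_pos (pow_pos hpos n)]
  refine mul_le_of_le_one_right (pow_pos hpos n).le ?_
  have hR0 := Matrix.nonneg_of_mem_rowStochastic (pow_mem hRs n) (i := i) (j := j)
  have hR1 := Matrix.le_one_of_mem_rowStochastic (pow_mem hRs n) (i := i) (j := j)
  have hwj : w j ≤ 1 := hw1 ▸ Finset.single_le_sum (fun i _ => hw0 i) (Finset.mem_univ j)
  have := hw0 j
  rw [abs_le]; constructor <;> linarith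

/-- Doeblin's estimate applies to an entrywise positive power `P ^ N`. Writing `n = n % N + N * (n /
N)`, the remaining `n % N` steps merely average the errors. -/
theorem tendsto_pow_of_isPrimitive (hP : P ∈ Matrix.rowStochastic ℝ S) (hprim : P.IsPrimitive)
    {w : S → ℝ} (hw : ∀ i, 0 < w i) (hw1 : ∑ i, w i = 1) (hst : Matrix.vecMul w P = w) (i j : S) :
    Filter.Tendsto (fun n : ℕ => (P ^ n) i j) Filter.atTop (nhds (w j)) := by
  obtain ⟨N, hN, hpos⟩ := hprim.exists_pos_pow
  have hwle : ∀ j, w j ≤ 1 := fun j =>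
    hw1 ▸ Finset.single_le_sum (fun i _ => (hw i).le) (Finset.mem_univ j)
  obtain ⟨δ, hδ0, hδ1, hδ⟩ : ∃ δ : ℝ, 0 < δ ∧ δ < 1 ∧ ∀ i j, δ * w j ≤ (P ^ N) i j := by
    obtain ⟨x, -, hx⟩ := Finset.exists_min_image (Finset.univ : Finset (S × S))
      (fun x => (P ^ N) x.1 x.2) ⟨(i, j), Finset.mem_univ _⟩
    -- The smallest entry of `P ^ N`, capped to stay below 1.
    refine ⟨min ((P ^ N) x.1 x.2) (1 / 2), lt_min (hpos _ _) (by norm_num),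
      (min_le_right _ _).trans_lt (by norm_num), fun i j => ?_⟩
    calc _ ≤ min ((P ^ N) x.1 x.2) (1 / 2) * 1 := by
          gcongr
          · exact le_min (hpos _ _).le (by norm_num)
          · exact hwle j
      _ ≤ (P ^ N) x.1 x.2 := by rw [mul_one]; exact min_le_left _ _
      _ ≤ _ := hx (i, j) (Finset.mem_univ _)
  have hQ := abs_pow_mul_sub_le (fun i => (hw i).le) hw1 (pow_mem hP N) (vecMul_pow_eq hst N) hδ1 hδ
  have hbound : ∀ n : ℕ, |(P ^ n) i j - w j| ≤ (1 - δ) ^ (n / N) := by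
    intro n
    have hrow := Matrix.sum_row_of_mem_rowStochastic (pow_mem hP (n % N)) i
    have hsplit : (P ^ n) i j - w j =
        ∑ l, (P ^ (n % N)) i l * (((P ^ N) ^ (n / N)) l j - w j) := by
      simp only [mul_sub, Finset.sum_sub_distrib, ← Finset.sum_mul, hrow, one_mul]
      rw [← Matrix.mul_apply, ← pow_mul, ← pow_add, Nat.mod_add_div]
    rw [hsplit]
    calc _ ≤ ∑ l, |(P ^ (n % N)) i l * (((P ^ N) ^ (n / N)) l j - w j)| :=
          Finset.abs_sum_le_sum_abs _ _
      _ ≤ ∑ l, (P ^ (n % N)) i l * (1 - δ) ^ (n / N) := by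
          refine Finset.sum_le_sum fun l _ => ?_
          have h0 := Matrix.nonneg_of_mem_rowStochastic (pow_mem hP (n % N)) (i := i) (j := l)
          rw [abs_mul, abs_of_nonneg h0]
          exact mul_le_mul_of_nonneg_left (hQ _ _ _) h0
      _ = _ := by rw [← Finset.sum_mul, hrow, one_mul]
  rw [tendsto_iff_dist_tendsto_zero]
  refine squeeze_zero (fun _ => dist_nonneg) hbound ?_
  exact (tendsto_pow_atTop_nhds_zero_of_lt_one (by linarith) (by linarith)).comp
    (Nat.tendsto_div_const_atTop hN.ne')

/-- The Poisson equation. -/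
theorem exists_poisson {w : S → ℝ} (hst : Matrix.vecMul w P = w) (hw1 : ∑ i, w i = 1)
    (hlim : ∀ i j, Filter.Tendsto (fun n : ℕ => (P ^ n) i j) Filter.atTop (nhds (w j)))
    (g : S → ℝ) (hg : ∑ i, w i * g i = 0) : ∃ h : S → ℝ, h - P.mulVec h = g := by
  have hmul : ∀ v i, (constRows w).mulVec v i = ∑ j, w j * v j := fun v i => rfl
  have hpair : ∀ v : S → ℝ, ∑ i, w i * P.mulVec v i = ∑ i, w i * v i := fun v => by
    change w ⬝ᵥ P.mulVec v = w ⬝ᵥ v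
    rw [Matrix.dotProduct_mulVec, hst]
  have hsum : ∀ v : S → ℝ, ∑ i, w i * (1 - P + constRows w).mulVec v i = ∑ i, w i * v i := by
    intro v
    simp only [Matrix.add_mulVec, Matrix.sub_mulVec, Matrix.one_mulVec, Pi.add_apply, Pi.sub_apply,
      hmul, mul_add, mul_sub, Finset.sum_add_distrib, Finset.sum_sub_distrib, hpair,
      ← Finset.sum_mul, hw1]
    ring
  -- A kernel vector `v` has `w`-mean zero, by pairing with `w`; hence `P v = v`, and `v = P ^ n v`
  -- tends to the constant `∑ w v = 0`. In finite dimension injectivity gives the solution for every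
  -- right-hand side.
  have hinj : Function.Injective (1 - P + constRows w).mulVecLin := by
    rw [← LinearMap.ker_eq_bot, LinearMap.ker_eq_bot']
    intro v hv
    rw [Matrix.mulVecLin_apply] at hv
    have h0 : ∑ i, w i * v i = 0 := by rw [← hsum, hv]; simp
    have hPv : P.mulVec v = v := by
      ext i
      have := congrFun hv i
      simp only [Matrix.add_mulVec, Matrix.sub_mulVec, Matrix.one_mulVec, Pi.add_apply,
        Pi.sub_apply, hmul, h0, Pi.zero_apply] at this
      linarith
    have hPn : ∀ n : ℕ, (P ^ n).mulVec v = v := fun n => by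
      induction n with
      | zero => simp
      | succ n ih => rw [pow_succ, ← Matrix.mulVec_mulVec, hPv, ih]
    ext i
    have h1 : Filter.Tendsto (fun n : ℕ => (P ^ n).mulVec v i) Filter.atTop
        (nhds (∑ j, w j * v j)) :=
      tendsto_finsetSum _ fun j _ => (hlim i j).mul_const _
    simp only [hPn, h0] at h1
    exact tendsto_nhds_unique tendsto_const_nhds h1
  obtain ⟨h, hh⟩ := LinearMap.injective_iff_surjective.1 hinj g
  refine ⟨h, ?_⟩
  rw [Matrix.mulVecLin_apply] at hh
  have h0 : ∑ i, w i * h i = 0 := by rw [← hsum, hh, hg]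
  ext i
  have := congrFun hh i
  simpa [Matrix.add_mulVec, Matrix.sub_mulVec, hmul, h0] using this

end Convergence

/-! ### Finite Markov chains: ergodic averages -/

section Ergodic

open MeasureTheory

variable {Ω : Type*} [MeasurableSpace Ω] {ℙ : Measure Ω}

/-- The expectation of a function of a random variable with finitely many values. -/
theorem integral_comp_finite [IsProbabilityMeasure ℙ] {T : Type*} [Fintype T] {X : Ω → T}
    (hX : ∀ t, MeasurableSet (X ⁻¹' {t})) (G : T → ℝ) :
    Integrable (fun ω => G (X ω)) ℙ ∧
      ∫ ω, G (X ω) ∂ℙ = ∑ t, ℙ.real {ω | X ω = t} * G t := by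
  let : MeasurableSpace T := ⊤
  have hXm : Measurable X := measurable_to_countable' hX
  have : IsProbabilityMeasure (ℙ.map X) := Measure.isProbabilityMeasure_map hXm.aemeasurable
  have hG : Integrable G (ℙ.map X) := Integrable.of_finite
  refine ⟨hG.comp_measurable hXm, ?_⟩
  rw [← integral_map hXm.aemeasurable hG.aestronglyMeasurable, integral_fintype hG]
  refine Finset.sum_congr rfl fun t _ => ?_
  rw [map_measureReal_apply hXm (MeasurableSet.singleton t)]
  rfl

variable {S : Type*} {P : Matrix S S ℝ} {Z : ℕ → Ω → S}

theorem IsMarkovChain.measurableSet_path (hZ : IsMarkovChain P ℙ Z) (n : ℕ)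
    (t : (Fin (n + 1) → S) × S) :
    MeasurableSet ((fun ω => ((fun i : Fin (n + 1) => Z i ω), Z (n + 1) ω)) ⁻¹' {t}) := by
  have : (fun ω => ((fun i : Fin (n + 1) => Z i ω), Z (n + 1) ω)) ⁻¹' {t} =
      (⋂ i : Fin (n + 1), Z i ⁻¹' {t.1 i}) ∩ Z (n + 1) ⁻¹' {t.2} := by
    ext ω
    simp [Prod.ext_iff, funext_iff]
  rw [this]
  exact (MeasurableSet.iInter fun i => hZ.1 _ _).inter (hZ.1 _ _)

theorem IsMarkovChain.real_path_succ (hZ : IsMarkovChain P ℙ Z) (n : ℕ) (w : Fin (n + 1) → S)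
    (s : S) :
    ℙ.real {ω | ((fun i : Fin (n + 1) => Z i ω), Z (n + 1) ω) = (w, s)} =
      ℙ.real {ω | (fun i : Fin (n + 1) => Z i ω) = w} * P (w (Fin.last n)) s := by
  -- `IsMarkovChain` speaks of infinite sequences but uses only their first `n + 2` terms, so the
  -- word `w` is continued by the constant `s`.
  have h := hZ.2 n fun k => if hk : k < n + 1 then w ⟨k, hk⟩ else s
  have e1 : {ω | ∀ k ≤ n + 1, Z k ω = if hk : k < n + 1 then w ⟨k, hk⟩ else s} =
      {ω | ((fun i : Fin (n + 1) => Z i ω), Z (n + 1) ω) = (w, s)} := by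
    ext ω
    simp only [Set.mem_ofPred_eq, Prod.mk.injEq, funext_iff]
    refine ⟨fun h => ⟨fun i => ?_, ?_⟩, fun h k hk => ?_⟩
    · simpa [i.2] using h i i.2.le
    · simpa using h (n + 1) le_rfl
    · split_ifs with hk'
      · exact h.1 ⟨k, hk'⟩
      · obtain rfl : k = n + 1 := by omega
        exact h.2
  have e2 : {ω | ∀ k ≤ n, Z k ω = if hk : k < n + 1 then w ⟨k, hk⟩ else s} =
      {ω | (fun i : Fin (n + 1) => Z i ω) = w} := by
    ext ω
    simp only [Set.mem_ofPred_eq, funext_iff]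
    refine ⟨fun h i => ?_, fun h k hk => ?_⟩
    · simpa [i.2] using h i (by omega)
    · rw [dif_pos (by omega)]; exact h ⟨k, by omega⟩
  rw [e1, e2] at h
  simpa [Fin.last] using h

/-- The sum of the `X n` has finite expectation, so it is almost surely finite and its terms tend to
0. -/
theorem ae_tendsto_zero_of_summable_integral {X : ℕ → Ω → ℝ} (h0 : ∀ n ω, 0 ≤ X n ω)
    (hX : ∀ n, Integrable (X n) ℙ) {b : ℕ → ℝ} (hb : ∀ n, ∫ ω, X n ω ∂ℙ ≤ b n)
    (hs : Summable b) :
    ∀ᵐ ω ∂ℙ, Filter.Tendsto (fun n => X n ω) Filter.atTop (nhds 0) := by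
  have hfin : ∫⁻ ω, ∑' n, ENNReal.ofReal (X n ω) ∂ℙ ≠ ⊤ := by
    rw [lintegral_tsum fun n => (hX n).aemeasurable.ennreal_ofReal]
    refine ne_top_of_le_ne_top hs.tsum_ofReal_ne_top (ENNReal.tsum_le_tsum fun n => ?_)
    rw [← ofReal_integral_eq_lintegral_ofReal (hX n) (Filter.Eventually.of_forall (h0 n))]
    exact ENNReal.ofReal_le_ofReal (hb n)
  filter_upwards [ae_lt_top' (AEMeasurable.tsum fun n =>
    (hX n).aemeasurable.ennreal_ofReal) hfin] with ω hω
  have := ENNReal.tendsto_atTop_zero_of_tsum_ne_top hω.ne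
  have := (ENNReal.tendsto_toReal ENNReal.zero_ne_top).comp this
  simpa [Function.comp_def, ENNReal.toReal_ofReal (h0 _ ω)] using this

variable [IsProbabilityMeasure ℙ] [Fintype S]

theorem IsMarkovChain.integrable_path (hZ : IsMarkovChain P ℙ Z) (n : ℕ)
    (G : (Fin (n + 1) → S) → S → ℝ) :
    Integrable (fun ω => G (fun i => Z i ω) (Z (n + 1) ω)) ℙ :=
  (integral_comp_finite (hZ.measurableSet_path n) fun t => G t.1 t.2).1

/-- The Markov property in integrated form. -/
theorem IsMarkovChain.integral_mul_succ (hZ : IsMarkovChain P ℙ Z) (n : ℕ)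
    (F : (Fin (n + 1) → S) → ℝ) (h : S → ℝ) :
    ∫ ω, F (fun i => Z i ω) * h (Z (n + 1) ω) ∂ℙ =
      ∫ ω, F (fun i => Z i ω) * P.mulVec h (Z n ω) ∂ℙ := by
  have hm : ∀ w, MeasurableSet ((fun ω => fun i : Fin (n + 1) => Z i ω) ⁻¹' {w}) := fun w => by
    have : (fun ω => fun i : Fin (n + 1) => Z i ω) ⁻¹' {w} =
        ⋂ i : Fin (n + 1), Z i ⁻¹' {w i} := by
      ext ω
      simp [funext_iff]
    rw [this]
    exact MeasurableSet.iInter fun i => hZ.1 _ _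
  rw [(integral_comp_finite (hZ.measurableSet_path n) fun t => F t.1 * h t.2).2,
    show ∫ ω, F (fun i => Z i ω) * P.mulVec h (Z n ω) ∂ℙ = _ from
      (integral_comp_finite hm fun w => F w * P.mulVec h (w (Fin.last n))).2,
    Fintype.sum_prod_type]
  refine Finset.sum_congr rfl fun w _ => ?_
  simp only [hZ.real_path_succ, Matrix.mulVec, dotProduct, Finset.mul_sum]
  exact Finset.sum_congr rfl fun s _ => by ring

/-- The martingale attached to a function on the state space. -/
def martingalePart (P : Matrix S S ℝ) (Z : ℕ → Ω → S) (h : S → ℝ) (n : ℕ) (ω : Ω) : ℝ :=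
  ∑ k ∈ Finset.range n, (h (Z (k + 1) ω) - P.mulVec h (Z k ω))

/-- Increments are orthogonal to the past: the martingale at time `n` is a function `F` of the path
up to `n`, so the cross term vanishes by `integral_mul_succ`, and each step adds at most `c`. -/
theorem IsMarkovChain.integral_martingalePart_sq_le (hZ : IsMarkovChain P ℙ Z) (h : S → ℝ) {c : ℝ}
    (hc : ∀ s t, (h t - P.mulVec h s) ^ 2 ≤ c) (n : ℕ) :
    Integrable (fun ω => martingalePart P Z h n ω ^ 2) ℙ ∧
      ∫ ω, martingalePart P Z h n ω ^ 2 ∂ℙ ≤ n * c := by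
  induction n with
  | zero => simp [martingalePart]
  | succ n ih =>
    obtain ⟨F, hF⟩ : ∃ F : (Fin (n + 1) → S) → ℝ, ∀ ω,
        martingalePart P Z h n ω = F fun i => Z i ω :=
      ⟨fun w => ∑ k : Fin n, (h (w k.succ) - P.mulVec h (w k.castSucc)), fun ω => by
        rw [martingalePart, ← Fin.sum_univ_eq_sum_range
          (fun k => h (Z (k + 1) ω) - P.mulVec h (Z k ω))]
        rfl⟩
    have hsq : ∀ ω, martingalePart P Z h (n + 1) ω ^ 2 = martingalePart P Z h n ω ^ 2 +
        (2 * (F (fun i => Z i ω) * h (Z (n + 1) ω) - F (fun i => Z i ω) * P.mulVec h (Z n ω)) +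
          (h (Z (n + 1) ω) - P.mulVec h (Z n ω)) ^ 2) := fun ω => by
      rw [← mul_sub, ← hF, martingalePart, Finset.sum_range_succ, ← martingalePart]
      ring
    have i1 := hZ.integrable_path n fun w s => F w * h s
    have i2 := hZ.integrable_path n fun w _ => F w * P.mulVec h (w (Fin.last n))
    have i3 := hZ.integrable_path n fun w s => (h s - P.mulVec h (w (Fin.last n))) ^ 2
    simp only [Fin.val_last] at i2 i3
    have i12 := (i1.sub i2).const_mul 2
    simp only [Pi.sub_apply] at i12
    simp only [hsq]
    have i123 := i12.add i3
    simp only [Pi.add_def] at i123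
    refine ⟨ih.1.add i123, ?_⟩
    rw [integral_add ih.1 i123, integral_add i12 i3, integral_const_mul,
      integral_sub i1 i2, hZ.integral_mul_succ, sub_self, mul_zero, zero_add]
    have h3 : ∫ ω, (h (Z (n + 1) ω) - P.mulVec h (Z n ω)) ^ 2 ∂ℙ ≤ c := by
      calc _ ≤ ∫ _, c ∂ℙ := integral_mono i3 (integrable_const c) fun ω => hc _ _
        _ = c := by simp
    push_cast
    linarith [ih.2]

theorem tendsto_mul_add_one_sq_inv (c : ℝ) : Filter.Tendsto
    (fun n : ℕ => c / (((n + 1) ^ 2 : ℕ) : ℝ)) Filter.atTop (nhds 0) := by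
  refine Filter.Tendsto.div_atTop tendsto_const_nhds (tendsto_natCast_atTop_atTop.comp ?_)
  exact (Filter.tendsto_pow_atTop two_ne_zero).comp (Filter.tendsto_add_atTop_nat 1)

/-- Consecutive squares have ratio tending to 1, so a monotone sequence is pinched between its
values at squares. -/
theorem tendsto_div_of_monotone_of_tendsto_div_sq {u : ℕ → ℝ} {l : ℝ} (hu : Monotone u)
    (h : Filter.Tendsto (fun n : ℕ => u ((n + 1) ^ 2) / (((n + 1) ^ 2 : ℕ) : ℝ)) Filter.atTop
      (nhds l)) : Filter.Tendsto (fun n : ℕ => u n / n) Filter.atTop (nhds l) := by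
  refine tendsto_div_of_monotone_of_exists_subseq_tendsto_div u l hu fun a ha =>
    ⟨fun n => (n + 1) ^ 2, ?_, (Filter.tendsto_pow_atTop two_ne_zero).comp
      (Filter.tendsto_add_atTop_nat 1), h⟩
  have h1 : Filter.Tendsto (fun n : ℕ => (1 + 1 / ((n : ℝ) + 1)) ^ 2) Filter.atTop
      (nhds ((1 + 0) ^ 2)) :=
    (tendsto_const_nhds.add tendsto_one_div_add_atTop_nhds_zero_nat).pow 2
  rw [add_zero, one_pow] at h1
  filter_upwards [h1.eventually_le_const ha] with n hn
  push_cast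
  have hpos : (0 : ℝ) < (n : ℝ) + 1 := by positivity
  calc ((n : ℝ) + 1 + 1) ^ 2 = (1 + 1 / ((n : ℝ) + 1)) ^ 2 * ((n : ℝ) + 1) ^ 2 := by
        field_simp
    _ ≤ a * ((n : ℝ) + 1) ^ 2 := by gcongr

/-- The ergodic theorem for a finite Markov chain whose powers converge. -/
theorem IsMarkovChain.ae_tendsto_average [DecidableEq S] (hZ : IsMarkovChain P ℙ Z) {w : S → ℝ}
    (hst : Matrix.vecMul w P = w) (hw1 : ∑ i, w i = 1)
    (hlim : ∀ i j, Filter.Tendsto (fun n : ℕ => (P ^ n) i j) Filter.atTop (nhds (w j)))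
    (f : S → ℝ) :
    ∀ᵐ ω ∂ℙ, Filter.Tendsto (fun n : ℕ => (∑ k ∈ Finset.range n, f (Z k ω)) / (n : ℝ))
      Filter.atTop (nhds (∑ s, w s * f s)) := by
  set l := ∑ s, w s * f s with hl
  obtain ⟨h, hh⟩ := exists_poisson hst hw1 hlim (fun s => f s - l) (by
    simp only [mul_sub, Finset.sum_sub_distrib, ← Finset.sum_mul, hw1, ← hl]
    ring)
  have hh' : ∀ s, P.mulVec h s = h s - (f s - l) := fun s => by
    have := congrFun hh s
    simp only [Pi.sub_apply] at this
    linarith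
  obtain ⟨c, hc⟩ : ∃ c, ∀ s t, (h t - P.mulVec h s) ^ 2 ≤ c := by
    obtain ⟨c, hc⟩ := (Set.finite_range fun x : S × S => (h x.2 - P.mulVec h x.1) ^ 2).bddAbove
    exact ⟨c, fun s t => hc ⟨(s, t), rfl⟩⟩
  obtain ⟨b, hb⟩ : ∃ b, ∀ s, |h s| ≤ b := by
    obtain ⟨b, hb⟩ := (Set.finite_range fun s : S => |h s|).bddAbove
    exact ⟨b, fun s => hb ⟨s, rfl⟩⟩
  -- Adding `d` makes `f` nonnegative and its partial sums monotone, as the passage from squares to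
  -- all `n` requires.
  obtain ⟨d, hd⟩ : ∃ d, ∀ s, -f s ≤ d := by
    obtain ⟨d, hd⟩ := (Set.finite_range fun s : S => -f s).bddAbove
    exact ⟨d, fun s => hd ⟨s, rfl⟩⟩
  -- The Poisson equation turns `f - l` at time `k` into a martingale increment plus a telescoping
  -- difference of `h`.
  have hsum : ∀ n ω, ∑ k ∈ Finset.range n, f (Z k ω) =
      n * l + martingalePart P Z h n ω + (h (Z 0 ω) - h (Z n ω)) := fun n ω => by
    induction n with
    | zero => simp [martingalePart]
    | succ n ih =>
      rw [Finset.sum_range_succ, ih, martingalePart, martingalePart, Finset.sum_range_succ, hh']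
      push_cast
      ring
  have hM := fun n => hZ.integral_martingalePart_sq_le h hc n
  -- At time `(n + 1) ^ 2` the normalised martingale has second moment at most `c / (n + 1) ^ 2`,
  -- which is summable.
  have hae : ∀ᵐ ω ∂ℙ, Filter.Tendsto (fun n : ℕ => (martingalePart P Z h ((n + 1) ^ 2) ω /
      (((n + 1) ^ 2 : ℕ) : ℝ)) ^ 2) Filter.atTop (nhds 0) := by
    refine ae_tendsto_zero_of_summable_integral (b := fun n : ℕ => c * (1 / ((n : ℝ) + 1) ^ 2))
      (fun n ω => sq_nonneg _) (fun n => ?_) (fun n => ?_) ?_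
    · simp only [div_pow]
      exact (hM _).1.div_const _
    · simp only [div_pow]
      rw [integral_div, div_le_iff₀ (by positivity)]
      refine (hM _).2.trans (le_of_eq ?_)
      push_cast
      field_simp
    · refine Summable.mul_left c ?_
      exact_mod_cast (summable_nat_add_iff 1).2 (Real.summable_one_div_nat_pow.2 one_lt_two)
  filter_upwards [hae] with ω hω
  have hM0 : Filter.Tendsto (fun n : ℕ => martingalePart P Z h ((n + 1) ^ 2) ω /
      (((n + 1) ^ 2 : ℕ) : ℝ)) Filter.atTop (nhds 0) := by
    rw [tendsto_zero_iff_abs_tendsto_zero]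
    have := hω.sqrt
    simpa [Real.sqrt_sq_eq_abs, Function.comp_def] using this
  have hB0 : Filter.Tendsto (fun n : ℕ => (h (Z 0 ω) - h (Z ((n + 1) ^ 2) ω)) /
      (((n + 1) ^ 2 : ℕ) : ℝ)) Filter.atTop (nhds 0) := by
    refine squeeze_zero_norm (fun n => ?_) (tendsto_mul_add_one_sq_inv (b + b))
    rw [norm_div, Real.norm_eq_abs, Real.norm_natCast]
    gcongr
    exact (abs_sub _ _).trans (add_le_add (hb _) (hb _))
  have hmono : Monotone fun n : ℕ => ∑ k ∈ Finset.range n, (f (Z k ω) + d) :=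
    monotone_nat_of_le_succ fun n => by
      rw [Finset.sum_range_succ]
      linarith [hd (Z n ω)]
  have key := tendsto_div_of_monotone_of_tendsto_div_sq (l := l + d) hmono (by
    have := (hM0.add hB0).const_add (l + d)
    rw [add_zero, add_zero] at this
    refine this.congr fun n => ?_
    rw [Finset.sum_add_distrib, hsum, Finset.sum_const, Finset.card_range, nsmul_eq_mul]
    have : (((n + 1) ^ 2 : ℕ) : ℝ) ≠ 0 := by positivity
    field_simp
    ring)
  have := key.sub_const d
  rw [add_sub_cancel_right] at this
  refine this.congr' ?_
  filter_upwards [Filter.eventually_gt_atTop 0] with n hn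
  rw [Finset.sum_add_distrib, Finset.sum_const, Finset.card_range, nsmul_eq_mul]
  have : (n : ℝ) ≠ 0 := by positivity
  field_simp
  ring

end Ergodic

/-! ### Trees with the running intersection property -/

section IntersectionTree

variable {V : Type*}

theorem reflTransGen_of_walk {α : Type*} {G : SimpleGraph α} {Q : α → Prop} {C D : α}
    (p : G.Walk C D) (hp : ∀ E ∈ p.support, Q E) :
    Relation.ReflTransGen (fun A B => G.Adj A B ∧ Q A ∧ Q B) C D := by
  induction p with
  | nil => exact .refl
  | cons h p ih =>
    simp only [SimpleGraph.Walk.support_cons, List.mem_cons, forall_eq_or_imp] at hp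
    exact .head ⟨h, hp.1, hp.2 _ p.start_mem_support⟩ (ih hp.2)

theorem exists_walk_of_reflTransGen {α : Type*} {G : SimpleGraph α} {Q : α → Prop} {C D : α}
    (h : Relation.ReflTransGen (fun A B => G.Adj A B ∧ Q A ∧ Q B) C D) (hD : Q D) :
    ∃ p : G.Walk C D, ∀ E ∈ p.support, Q E := by
  induction h using Relation.ReflTransGen.head_induction_on with
  | refl => exact ⟨.nil, by simpa using hD⟩
  | head h _ ih =>
    obtain ⟨p, hp⟩ := ih
    refine ⟨.cons h.1 p, ?_⟩
    simp only [SimpleGraph.Walk.support_cons, List.mem_cons, forall_eq_or_imp]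
    exact ⟨h.2.1, hp⟩

theorem reflTransGen_adj_symm {α : Type*} {G : SimpleGraph α} {Q : α → Prop} {C D : α}
    (h : Relation.ReflTransGen (fun A B => G.Adj A B ∧ Q A ∧ Q B) C D) :
    Relation.ReflTransGen (fun A B => G.Adj A B ∧ Q A ∧ Q B) D C := by
  have : Std.Symm (fun A B => G.Adj A B ∧ Q A ∧ Q B) :=
    ⟨fun _ _ h => ⟨h.1.symm, h.2.2, h.2.1⟩⟩
  exact Std.Symm.symm _ _ h

/-- The nodes of `T` with property `Q` are connected through links between such nodes. -/
def CliqueTree.Linked (T : CliqueTree V) (Q : Finset V → Prop) : Prop :=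
  ∀ C ∈ T.nodes, ∀ D ∈ T.nodes, Q C → Q D →
    Relation.ReflTransGen (fun A B => T.links.Adj A B ∧ Q A ∧ Q B) C D

/-- `T` is a tree in which the nodes containing any given vertex form a subtree. That the links form
a tree is expressed by connectedness and a bound on their number. -/
structure CliqueTree.IsIntersectionTree (T : CliqueTree V) : Prop where
  nonempty : T.nodes.Nonempty
  mem_of_link : ∀ {C D}, T.links.Adj C D → C ∈ T.nodes
  connected : T.Linked fun _ => True
  linked : ∀ v, T.Linked fun C => v ∈ C
  card_le : T.links.edgeSet.ncard + 1 ≤ T.nodes.card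

theorem CliqueTree.card_edgeSet_induce {T : CliqueTree V}
    (h : ∀ {C D}, T.links.Adj C D → C ∈ T.nodes) :
    Nat.card (T.links.induce (T.nodes : Set (Finset V))).edgeSet = T.links.edgeSet.ncard := by
  rw [Nat.card_coe_set_eq,
    ← Set.ncard_image_of_injective _ (Sym2.map.injective Subtype.val_injective)]
  congr 1
  ext e
  induction e with | _ C D
  refine ⟨?_, fun hCD => ⟨s(⟨C, h hCD⟩, ⟨D, h hCD.symm⟩), hCD, rfl⟩⟩
  rintro ⟨e, he, heq⟩
  induction e with | _ A B
  rw [Sym2.map_mk] at heq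
  rw [← heq]
  exact he

/-- A connected graph has at least as many edges as vertices minus one; `card_le` forces equality,
which characterises trees. -/
theorem CliqueTree.IsIntersectionTree.isTree [Finite V] {T : CliqueTree V}
    (hT : T.IsIntersectionTree) : (T.links.induce (T.nodes : Set (Finset V))).IsTree := by
  have hreach : ∀ (C : Finset V) (hC : C ∈ T.nodes) (D : Finset V),
      Relation.ReflTransGen (fun A B => T.links.Adj A B ∧ True ∧ True) C D →
      ∃ hD : D ∈ T.nodes, (T.links.induce (T.nodes : Set (Finset V))).Reachable ⟨C, hC⟩ ⟨D, hD⟩ := by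
    intro C hC D h
    induction h with
    | refl => exact ⟨hC, .rfl⟩
    | tail _ h ih =>
      obtain ⟨hB, hr⟩ := ih
      exact ⟨hT.mem_of_link h.1.symm, hr.trans (SimpleGraph.Adj.reachable (by exact h.1))⟩
  have hconn : (T.links.induce (T.nodes : Set (Finset V))).Connected := by
    obtain ⟨Z, hZ⟩ := hT.nonempty
    exact { preconnected := fun C D =>
              (hreach C C.2 D (hT.connected _ C.2 _ D.2 trivial trivial)).2
            nonempty := ⟨⟨Z, hZ⟩⟩ }
  refine SimpleGraph.isTree_iff_connected_and_card.2 ⟨hconn, ?_⟩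
  have h1 := hconn.card_vert_le_card_edgeSet_add_one
  have h2 := hT.card_le
  rw [card_edgeSet_induce hT.mem_of_link] at h1 ⊢
  have h3 : Nat.card (T.nodes : Set (Finset V)) = T.nodes.card := by simp
  omega

theorem CliqueTree.IsIntersectionTree.mem_of_mem_support {T : CliqueTree V}
    (hT : T.IsIntersectionTree) {C D : Finset V} (p : T.links.Walk C D) (hC : C ∈ T.nodes) :
    ∀ E ∈ p.support, E ∈ T.nodes := by
  induction p with
  | nil => simpa using hC
  | cons h p ih =>
    simp only [SimpleGraph.Walk.support_cons, List.mem_cons, forall_eq_or_imp]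
    exact ⟨hC, ih (hT.mem_of_link h.symm)⟩

theorem CliqueTree.IsIntersectionTree.path_unique [Finite V] {T : CliqueTree V}
    (hT : T.IsIntersectionTree) {C D : Finset V} (hC : C ∈ T.nodes) {p q : T.links.Walk C D}
    (hp : p.IsPath) (hq : q.IsPath) : p = q := by
  have hps := hT.mem_of_mem_support p hC
  have hqs := hT.mem_of_mem_support q hC
  rw [← p.map_induce (s := (T.nodes : Set (Finset V))) hps] at hp ⊢
  rw [← q.map_induce (s := (T.nodes : Set (Finset V))) hqs] at hq ⊢
  have := (hT.isTree.isAcyclic.subsingleton_path _ _).elim ⟨_, hp.of_map⟩ ⟨_, hq.of_map⟩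
  rw [Subtype.mk.injEq] at this
  rw [this]

theorem CliqueTree.isClique_graph {T : CliqueTree V} {C : Finset V} (hC : C ∈ T.nodes) :
    T.graph.IsClique (C : Set V) := fun _ hx _ hy hne => ⟨hne, C, hC, hx, hy⟩

theorem exists_isMaxClique_of_isClique [Finite V] {G : SimpleGraph V} {K : Finset V}
    (hK : G.IsClique (K : Set V)) : ∃ C, K ⊆ C ∧ IsMaxClique G C :=
  Finite.exists_le_maximal hK

variable [DecidableEq V]

/-- For `v ∈ C ∩ D` there is a walk from `C` to `D` through nodes containing `v`. The path extracted
from it is `p`, as paths in a tree are unique. -/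
theorem CliqueTree.IsIntersectionTree.junction [Finite V] {T : CliqueTree V}
    (hT : T.IsIntersectionTree) {C D E : Finset V} (hC : C ∈ T.nodes) (p : T.links.Walk C D)
    (hp : p.IsPath) (hE : E ∈ p.support) : C ∩ D ⊆ E := by
  intro v hv
  rw [Finset.mem_inter] at hv
  have hD := hT.mem_of_mem_support p hC D p.end_mem_support
  obtain ⟨q, hq⟩ := exists_walk_of_reflTransGen (hT.linked v C hC D hD hv.1 hv.2) hv.2
  rw [hT.path_unique hC hp q.bypass_isPath] at hE
  exact hq E (q.support_bypass_subset_support hE)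

theorem CliqueTree.IsJunctionTreeOf.isIntersectionTree [Finite V] {T : CliqueTree V}
    {G : SimpleGraph V} (hT : T.IsJunctionTreeOf G) : T.IsIntersectionTree := by
  have hlink : ∀ {C D}, T.links.Adj C D → C ∈ T.nodes := fun h => (hT.mem_of_link _ _ h).1
  have hpath : ∀ C ∈ T.nodes, ∀ D ∈ T.nodes, ∃ p : T.links.Walk C D, p.IsPath := by
    intro C hC D hD
    obtain ⟨p, hp⟩ := hT.isTree.connected.exists_isPath ⟨C, hC⟩ ⟨D, hD⟩
    exact ⟨p.map (SimpleGraph.Embedding.induce _).toHom,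
      SimpleGraph.Walk.IsPath.map Subtype.val_injective hp⟩
  refine ⟨?_, hlink, fun C hC D hD _ _ => ?_, fun v C hC D hD hvC hvD => ?_, ?_⟩
  · obtain ⟨⟨Z, hZ⟩⟩ := hT.isTree.connected.nonempty
    exact ⟨Z, hZ⟩
  · obtain ⟨p, -⟩ := hpath C hC D hD
    exact reflTransGen_of_walk p fun _ _ => trivial
  · obtain ⟨p, hp⟩ := hpath C hC D hD
    exact reflTransGen_of_walk p fun E hE =>
      hT.junction C hC D hD p hp E hE (Finset.mem_inter.2 ⟨hvC, hvD⟩)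
  · rw [← card_edgeSet_induce hlink]
    refine (SimpleGraph.isTree_iff_connected_and_card.1 hT.isTree).2.le.trans ?_
    simp

/-! #### Leaves -/

theorem CliqueTree.Linked.erase_leaf {T : CliqueTree V} {Q : Finset V → Prop} {Z W : Finset V}
    (hQ : T.Linked Q) (hZ : ∀ D, T.links.Adj Z D → D = W) :
    CliqueTree.Linked ⟨T.nodes.erase Z, T.links.deleteEdges {s(Z, W)}⟩ Q := by
  intro C hC D hD hQC hQD
  rw [Finset.mem_erase] at hC hD
  -- Retract the leaf `Z` onto its only neighbour `W`: a chain in the old tree becomes a chain in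
  -- the new one, with steps to or from `Z` collapsed.
  suffices ∀ X, Relation.ReflTransGen (fun A B => T.links.Adj A B ∧ Q A ∧ Q B) C X →
      Relation.ReflTransGen
        (fun A B => (T.links.deleteEdges {s(Z, W)}).Adj A B ∧ Q A ∧ Q B) C (if X = Z then W else X) by
    simpa [hD.1] using this D (hQ C hC.2 D hD.2 hQC hQD)
  intro X hX
  induction hX with
  | refl => rw [if_neg hC.1]
  | @tail A B _ h ih =>
    by_cases hA : A = Z
    · subst hA
      have hB : B ≠ A := h.1.ne'
      rw [if_pos rfl] at ih
      rw [if_neg hB, hZ B h.1]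
      exact ih
    · rw [if_neg hA] at ih
      by_cases hB : B = Z
      · subst hB
        rw [if_pos rfl]
        rwa [hZ A h.1.symm] at ih
      · rw [if_neg hB]
        refine ih.tail ⟨?_, h.2⟩
        rw [SimpleGraph.deleteEdges_adj]
        refine ⟨h.1, ?_⟩
        simp [hA, hB]

/-- A tree with at least two nodes has a leaf `Z`, linked to `W`, that can be removed. -/
theorem CliqueTree.IsIntersectionTree.exists_leaf [Finite V] {T : CliqueTree V}
    (hT : T.IsIntersectionTree) (hcard : 1 < T.nodes.card) :
    ∃ (T' : CliqueTree V) (W Z : Finset V), T'.IsIntersectionTree ∧ W ∈ T'.nodes ∧ Z ∉ T'.nodes ∧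
      T.nodes = insert Z T'.nodes ∧ ∀ D ∈ T'.nodes, Z ∩ D ⊆ W := by
  classical
  have : Fintype (T.nodes : Set (Finset V)) := Fintype.ofFinite _
  have : Nontrivial (T.nodes : Set (Finset V)) :=
    (Finset.one_lt_card_iff_nontrivial.1 hcard).coe_sort
  obtain ⟨⟨Z, hZ⟩, hdeg⟩ := hT.isTree.exists_vert_degree_one_of_nontrivial
  obtain ⟨⟨W, hW⟩, hZW, huniq⟩ := SimpleGraph.degree_eq_one_iff_existsUnique_adj.1 hdeg
  have hZW : T.links.Adj Z W := hZW
  have hleaf : ∀ D, T.links.Adj Z D → D = W := fun D hD =>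
    congrArg Subtype.val (huniq ⟨D, hT.mem_of_link hD.symm⟩ hD)
  have hW' : W ∈ T.nodes.erase Z := Finset.mem_erase.2 ⟨hZW.ne', hW⟩
  refine ⟨⟨T.nodes.erase Z, T.links.deleteEdges {s(Z, W)}⟩, W, Z,
    ⟨⟨W, hW'⟩, fun {C D} h => ?_, hT.connected.erase_leaf hleaf,
      fun v => (hT.linked v).erase_leaf hleaf, ?_⟩, hW', Finset.notMem_erase _ _,
      (Finset.insert_erase hZ).symm, fun D hD v hv => ?_⟩
  · rw [SimpleGraph.deleteEdges_adj] at h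
    refine Finset.mem_erase.2 ⟨?_, hT.mem_of_link h.1⟩
    rintro rfl
    exact h.2 (by rw [hleaf D h.1]; rfl)
  · have h1 := hT.card_le
    have h2 := Set.ncard_sdiff_singleton_add_one (s := T.links.edgeSet)
      ((SimpleGraph.mem_edgeSet _).2 hZW) (Set.toFinite _)
    have h3 := Finset.card_erase_add_one hZ
    simp only [SimpleGraph.edgeSet_deleteEdges]
    omega
  -- A chain of nodes containing `v` from `Z` to `D` must begin with the step to `W`.
  · rw [Finset.mem_inter] at hv
    have hD := Finset.mem_erase.1 hD
    rcases Relation.ReflTransGen.cases_head (hT.linked v Z hZ D hD.2 hv.1 hv.2) with h | ⟨B, hB, -⟩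
    · exact absurd h.symm hD.1
    · exact hleaf B hB.1 ▸ hB.2.2

theorem CliqueTree.Linked.insert {T T' : CliqueTree V} {Q : Finset V → Prop} {Z : Finset V}
    (hnodes : T'.nodes = insert Z T.nodes)
    (hQ : ∀ C ∈ T.nodes, ∀ D ∈ T.nodes, Q C → Q D →
      Relation.ReflTransGen (fun A B => T'.links.Adj A B ∧ Q A ∧ Q B) C D)
    (h : ∀ D ∈ T.nodes, Q D → Q Z → ∃ W ∈ T.nodes, T'.links.Adj W Z ∧ Q W) : T'.Linked Q := by
  have hZ : ∀ C ∈ T.nodes, Q C → Q Z →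
      Relation.ReflTransGen (fun A B => T'.links.Adj A B ∧ Q A ∧ Q B) C Z := by
    intro C hC hQC hQZ
    obtain ⟨W, hW, hadj, hQW⟩ := h C hC hQC hQZ
    exact (hQ C hC W hW hQC hQW).tail ⟨hadj, hQW, hQZ⟩
  intro C hC D hD hQC hQD
  rw [hnodes, Finset.mem_insert] at hC hD
  rcases hC with rfl | hC <;> rcases hD with rfl | hD
  · exact .refl
  · exact reflTransGen_adj_symm (hZ D hD hQD hQC)
  · exact hZ C hC hQC hQD
  · exact hQ C hC D hD hQC hQD

/-- Attach a new leaf. -/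
theorem CliqueTree.IsIntersectionTree.addLeaf [Finite V] {T : CliqueTree V}
    (hT : T.IsIntersectionTree) {W Z : Finset V} (hW : W ∈ T.nodes) (hZ : Z ∉ T.nodes)
    (h : ∀ D ∈ T.nodes, Z ∩ D ⊆ W) :
    CliqueTree.IsIntersectionTree ⟨insert Z T.nodes, T.links ⊔ SimpleGraph.edge W Z⟩ := by
  have hne : W ≠ Z := fun e => hZ (e ▸ hW)
  have hadj : (T.links ⊔ SimpleGraph.edge W Z).Adj W Z := by
    simp [SimpleGraph.edge_adj, hne]
  have hmono : ∀ {Q : Finset V → Prop}, T.Linked Q → ∀ C ∈ T.nodes, ∀ D ∈ T.nodes, Q C → Q D →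
      Relation.ReflTransGen
        (fun A B => (T.links ⊔ SimpleGraph.edge W Z).Adj A B ∧ Q A ∧ Q B) C D :=
    fun hQ C hC D hD hQC hQD =>
      Relation.ReflTransGen.mono (fun A B hAB => ⟨Or.inl hAB.1, hAB.2⟩) _ _ (hQ C hC D hD hQC hQD)
  refine ⟨Finset.insert_nonempty _ _, fun {C D} hCD => ?_,
    .insert rfl (hmono hT.connected) fun _ _ _ _ => ⟨W, hW, hadj, trivial⟩,
    fun v => .insert rfl (hmono (hT.linked v)) fun D hD hvD hvZ =>
      ⟨W, hW, hadj, h D hD (Finset.mem_inter.2 ⟨hvZ, hvD⟩)⟩, ?_⟩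
  · rw [SimpleGraph.sup_adj, SimpleGraph.edge_adj] at hCD
    rcases hCD with h | ⟨⟨rfl, rfl⟩ | ⟨rfl, rfl⟩, -⟩
    · exact Finset.mem_insert_of_mem (hT.mem_of_link h)
    · exact Finset.mem_insert_of_mem hW
    · exact Finset.mem_insert_self _ _
  · have h1 := hT.card_le
    have h2 : (T.links ⊔ SimpleGraph.edge W Z).edgeSet.ncard ≤ T.links.edgeSet.ncard + 1 := by
      rw [SimpleGraph.edgeSet_sup, SimpleGraph.edgeSet_edge_of_ne hne]
      exact (Set.ncard_union_le _ _).trans (by simp)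
    rw [Finset.card_insert_of_notMem hZ]
    exact Nat.succ_le_succ (h2.trans h1)

/-- The Helly property: a set of vertices any two of which share a node lies in one node. -/
theorem CliqueTree.IsIntersectionTree.exists_subset [Finite V] {T : CliqueTree V}
    (hT : T.IsIntersectionTree) {K : Finset V}
    (hK : ∀ x ∈ K, ∀ y ∈ K, ∃ C ∈ T.nodes, x ∈ C ∧ y ∈ C) : ∃ C ∈ T.nodes, K ⊆ C := by
  induction hn : T.nodes.card using Nat.strong_induction_on generalizing T with
  | _ n ih =>
    subst hn
    rcases (Finset.one_le_card.2 hT.nonempty).eq_or_lt with h1 | h1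
    · obtain ⟨C, hC⟩ := Finset.card_eq_one.1 h1.symm
      refine ⟨C, by simp [hC], fun x hx => ?_⟩
      simpa [hC] using hK x hx x hx
    · obtain ⟨T', W, Z, hT', hW, hZ, hnodes, hsub⟩ := hT.exists_leaf h1
      by_cases hKZ : K ⊆ Z
      · exact ⟨Z, by simp [hnodes], hKZ⟩
      obtain ⟨k, hkK, hkZ⟩ := Finset.not_subset.1 hKZ
      -- A node shared by `x` and `k` is not `Z`, so it lies in the smaller tree and meets `Z`
      -- inside `W`. Thus `W` can stand in for `Z`.
      have hmem : ∀ x ∈ K, x ∈ Z → x ∈ W := by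
        intro x hx hxZ
        obtain ⟨C, hC, hxC, hkC⟩ := hK x hx k hkK
        rw [hnodes, Finset.mem_insert] at hC
        rcases hC with rfl | hC
        · exact absurd hkC hkZ
        · exact hsub C hC (Finset.mem_inter.2 ⟨hxZ, hxC⟩)
      obtain ⟨C, hC, hKC⟩ := ih T'.nodes.card
        (by rw [hnodes, Finset.card_insert_of_notMem hZ]; omega) hT' (fun x hx y hy => by
          obtain ⟨C, hC, hxC, hyC⟩ := hK x hx y hy
          rw [hnodes, Finset.mem_insert] at hC
          rcases hC with rfl | hC
          · exact ⟨W, hW, hmem x hx hxC, hmem y hy hyC⟩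
          · exact ⟨C, hC, hxC, hyC⟩) rfl
      exact ⟨C, by rw [hnodes]; exact Finset.mem_insert_of_mem hC, hKC⟩

/-- A tree with the running intersection property, whose nodes cover all vertices, is a junction
tree as soon as no node contains a node linked to it. -/
theorem CliqueTree.IsIntersectionTree.isJunctionTreeOf [Finite V] {T : CliqueTree V}
    (hT : T.IsIntersectionTree) (hcov : ∀ v, ∃ C ∈ T.nodes, v ∈ C)
    (hanti : ∀ A B, T.links.Adj A B → ¬ A ⊆ B) : T.IsJunctionTreeOf T.graph := by
  have hsub : ∀ K : Finset V, T.graph.IsClique (K : Set V) → ∃ C ∈ T.nodes, K ⊆ C := by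
    intro K hK
    refine hT.exists_subset fun x hx y hy => ?_
    by_cases hxy : x = y
    · subst hxy
      obtain ⟨C, hC, hxC⟩ := hcov x
      exact ⟨C, hC, hxC, hxC⟩
    · exact (hK hx hy hxy).2
  have heq : ∀ C ∈ T.nodes, ∀ D ∈ T.nodes, C ⊆ D → C = D := by
    intro C hC D hD hCD
    -- If `C ⊆ D` with `C ≠ D`, the first node after `C` on the path to `D` contains `C ∩ D = C`,
    -- which `hanti` forbids.
    obtain ⟨p, -⟩ := exists_walk_of_reflTransGen (hT.connected C hC D hD trivial trivial) trivial
    have hp := p.bypass_isPath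
    generalize p.bypass = q at hp
    cases q with
    | nil => rfl
    | @cons _ B _ h q =>
      refine absurd ?_ (hanti C B h)
      have := hT.junction hC _ hp (E := B) (by simp)
      rwa [Finset.inter_eq_left.2 hCD] at this
  refine ⟨fun C => ⟨fun hC => ⟨isClique_graph hC, fun K hK hCK => ?_⟩, fun hC => ?_⟩,
    fun C D h => ⟨hT.mem_of_link h, hT.mem_of_link h.symm⟩, hT.isTree,
    fun C hC D _ p hp E hE => hT.junction hC p hp hE⟩
  · obtain ⟨D, hD, hKD⟩ := hsub K hK
    rw [heq C hC D hD (hCK.trans hKD)]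
    exact hKD
  · obtain ⟨D, hD, hCD⟩ := hsub C hC.1
    rwa [hC.eq_of_le (isClique_graph hD) hCD]

/-! ### Decomposable graphs are the graphs with a junction tree -/

theorem CliqueTree.IsJunctionTreeOf.graph_eq [Finite V] {T : CliqueTree V} {G : SimpleGraph V}
    (hT : T.IsJunctionTreeOf G) : T.graph = G := by
  ext x y
  refine ⟨fun ⟨hne, C, hC, hx, hy⟩ => ((hT.mem_nodes_iff C).1 hC).1 hx hy hne, fun h => ?_⟩
  obtain ⟨C, hxyC, hC⟩ := exists_isMaxClique_of_isClique (G := G) (K := {x, y})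
    (by simpa [SimpleGraph.isClique_pair] using fun _ => h)
  exact ⟨h.ne, C, (hT.mem_nodes_iff C).2 hC, hxyC (by simp), hxyC (by simp)⟩

/-- A removed leaf is numbered last: it meets each earlier node inside its neighbour, which serves
as `k`. -/
theorem CliqueTree.IsIntersectionTree.exists_enumeration [Finite V] {T : CliqueTree V}
    (hT : T.IsIntersectionTree) :
    ∃ C : ℕ → Finset V, Set.InjOn C (Set.Iio T.nodes.card) ∧
      (∀ D, D ∈ T.nodes ↔ ∃ i < T.nodes.card, C i = D) ∧
      ∀ i < T.nodes.card, 0 < i → ∃ k < i, ∀ j < i, C i ∩ C j ⊆ C k := by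
  induction hn : T.nodes.card using Nat.strong_induction_on generalizing T with
  | _ n ih =>
    subst hn
    rcases (Finset.one_le_card.2 hT.nonempty).eq_or_lt with h1 | h1
    · obtain ⟨C, hC⟩ := Finset.card_eq_one.1 h1.symm
      refine ⟨fun _ => C, fun i hi j hj _ => ?_, fun D => ?_, fun i hi hi0 => ?_⟩
      · rw [Set.mem_Iio] at hi hj; omega
      · simp [hC, eq_comm]
      · omega
    · obtain ⟨T', W, Z, hT', hW, hZ, hnodes, hsub⟩ := hT.exists_leaf h1
      have hcard : T.nodes.card = T'.nodes.card + 1 := by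
        rw [hnodes, Finset.card_insert_of_notMem hZ]
      rw [hcard]
      obtain ⟨C, hinj, hmem, hrip⟩ := ih T'.nodes.card (by omega) hT' rfl
      have hCmem : ∀ i < T'.nodes.card, C i ∈ T'.nodes := fun i hi => (hmem _).2 ⟨i, hi, rfl⟩
      have hlt : ∀ i < T'.nodes.card, (if i = T'.nodes.card then Z else C i) = C i :=
        fun i hi => if_neg hi.ne
      refine ⟨fun i => if i = T'.nodes.card then Z else C i, fun i hi j hj hij => ?_, fun D => ?_,
        fun i hi hi0 => ?_⟩
      · rw [Set.mem_Iio] at hi hj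
        dsimp only at hij
        split_ifs at hij with h h' h'
        · rw [h, h']
        · exact absurd (hij ▸ hCmem j (by omega)) hZ
        · exact absurd (hij ▸ hCmem i (by omega)) hZ
        · exact hinj (show i < _ by omega) (show j < _ by omega) hij
      · rw [hnodes, Finset.mem_insert, hmem]
        constructor
        · rintro (rfl | ⟨i, hi, rfl⟩)
          · exact ⟨T'.nodes.card, by omega, if_pos rfl⟩
          · exact ⟨i, by omega, hlt i hi⟩
        · rintro ⟨i, hi, rfl⟩
          dsimp only
          split_ifs with h
          · exact Or.inl rfl
          · exact Or.inr ⟨i, by omega, rfl⟩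
      · rcases (Nat.lt_succ_iff.1 hi).eq_or_lt with rfl | hi
        · obtain ⟨k, hk, rfl⟩ := (hmem W).1 hW
          refine ⟨k, hk, fun j hj => ?_⟩
          simp only [if_true, hlt j hj, hlt k hk]
          exact hsub _ (hCmem j hj)
        · obtain ⟨k, hk, h⟩ := hrip i hi hi0
          refine ⟨k, hk, fun j hj => ?_⟩
          simp only [hlt i hi, hlt j (hj.trans hi), hlt k (hk.trans hi)]
          exact h j hj

theorem CliqueTree.IsJunctionTreeOf.isDecomposable [Finite V] {T : CliqueTree V}
    {G : SimpleGraph V} (hT : T.IsJunctionTreeOf G) : IsDecomposable G := by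
  obtain ⟨C, hinj, hmem, hrip⟩ := hT.isIntersectionTree.exists_enumeration
  refine ⟨T.nodes.card, fun i => C i, fun i j hij => Fin.ext (hinj i.2 j.2 hij), fun D => ?_,
    fun i hi => ?_⟩
  · rw [← hT.mem_nodes_iff, hmem, Fin.exists_iff]
    simp only [exists_prop]
  · obtain ⟨k, hk, h⟩ := hrip i i.2 hi
    refine ⟨⟨k, hk.trans i.2⟩, hk, ?_⟩
    rw [Finset.inter_biUnion]
    refine Finset.biUnion_subset.2 fun j hj => h j ?_
    simpa using hj

/-- Attach each clique in turn as a leaf to the earlier clique given by the running intersection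
property. -/
theorem IsDecomposable.exists_isJunctionTreeOf [Finite V] {G : SimpleGraph V}
    (hG : IsDecomposable G) : ∃ T : CliqueTree V, T.IsJunctionTreeOf G := by
  obtain ⟨c, C, hinj, hmax, hrip⟩ := hG
  -- The empty set is complete, hence contained in some clique, even when there are no vertices.
  have hc : 0 < c := by
    obtain ⟨D, -, hD⟩ := exists_isMaxClique_of_isClique (G := G) (K := ∅) (by simp)
    obtain ⟨i, -⟩ := (hmax D).1 hD
    exact i.pos
  have key : ∀ n, 0 < n → n ≤ c → ∃ T : CliqueTree V, T.IsIntersectionTree ∧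
      ∀ D, D ∈ T.nodes ↔ ∃ i : Fin c, (i : ℕ) < n ∧ C i = D := by
    intro n hn
    induction n, hn using Nat.le_induction with
    | base =>
      intro _
      refine ⟨⟨{C ⟨0, hc⟩}, ⊥⟩, ⟨by simp, by simp, ?_, fun v => ?_, by simp⟩, fun D => ?_⟩
      · intro A hA B hB _ _
        rw [Finset.mem_singleton.1 hA, Finset.mem_singleton.1 hB]
      · intro A hA B hB _ _
        rw [Finset.mem_singleton.1 hA, Finset.mem_singleton.1 hB]
      · rw [Finset.mem_singleton]
        constructor
        · rintro rfl
          exact ⟨⟨0, hc⟩, by simp, rfl⟩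
        · rintro ⟨i, hi, rfl⟩
          congr
          exact Fin.ext (by simpa using hi)
    | succ n hn ih =>
      intro hnc
      obtain ⟨T, hT, hmem⟩ := ih (by omega)
      obtain ⟨k, hk, hsub⟩ := hrip ⟨n, hnc⟩ hn
      refine ⟨_, hT.addLeaf (W := C k) (Z := C ⟨n, hnc⟩) ((hmem _).2 ⟨k, hk, rfl⟩) ?_ ?_,
        fun D => ?_⟩
      · rw [hmem]
        rintro ⟨i, hi, h⟩
        rw [hinj h] at hi
        exact lt_irrefl _ hi
      · intro D hD
        obtain ⟨i, hi, rfl⟩ := (hmem D).1 hD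
        refine (Finset.inter_subset_inter_left ?_).trans hsub
        exact Finset.subset_biUnion_of_mem C
          (Finset.mem_filter.2 ⟨Finset.mem_univ i, Fin.lt_def.2 hi⟩)
      · rw [Finset.mem_insert, hmem]
        constructor
        · rintro (rfl | ⟨i, hi, rfl⟩)
          · exact ⟨⟨n, hnc⟩, by simp, rfl⟩
          · exact ⟨i, by omega, rfl⟩
        · rintro ⟨i, hi, rfl⟩
          rcases (Nat.lt_succ_iff.1 hi).eq_or_lt with h | h
          · exact Or.inl (congrArg C (Fin.ext h))
          · exact Or.inr ⟨i, h, rfl⟩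
  obtain ⟨T, hT, hmem⟩ := key c hc le_rfl
  have hnodes : ∀ D, D ∈ T.nodes ↔ IsMaxClique G D := fun D => by
    rw [hmem, hmax]
    simp
  exact ⟨T, hnodes, fun A B h => ⟨hT.mem_of_link h, hT.mem_of_link h.symm⟩, hT.isTree,
    fun A hA B _ p hp E hE => hT.junction hA p hp hE⟩

end IntersectionTree

/-! ### The target distribution -/

section Target

variable {V : Type*} [DecidableEq V]

/-- A junction tree determines its graph, so `μ(G)` is the size of a fibre; this lets `sum_target`
sum fibrewise. -/
theorem numJunctionTrees_eq [Finite V] (G : SimpleGraph V) :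
    numJunctionTrees G = Nat.card {J : JunctionTree V // J.tree.graph = G} :=
  Nat.card_congr
    { toFun := fun T => ⟨⟨T.1, by rw [T.2.graph_eq]; exact T.2⟩, T.2.graph_eq⟩
      invFun := fun J => ⟨J.1.tree,
        J.2.subst (motive := fun H => J.1.tree.IsJunctionTreeOf H) J.1.isJunctionTree⟩
      left_inv := fun _ => rfl
      right_inv := fun _ => rfl }

theorem numJunctionTrees_pos [Finite V] {G : SimpleGraph V} (hG : IsDecomposable G) :
    0 < numJunctionTrees G := by
  obtain ⟨T, hT⟩ := hG.exists_isJunctionTreeOf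
  have : Nonempty {T : CliqueTree V // T.IsJunctionTreeOf G} := ⟨⟨T, hT⟩⟩
  exact Nat.card_pos

theorem target_pos [Finite V] {π : SimpleGraph V → ℝ} (hπ : ∀ G, IsDecomposable G → 0 < π G)
    (J : JunctionTree V) : 0 < target π J :=
  div_pos (hπ _ J.isJunctionTree.isDecomposable)
    (Nat.cast_pos.2 (numJunctionTrees_pos J.isJunctionTree.isDecomposable))

theorem sum_target [Fintype V] {π : SimpleGraph V → ℝ} (hπ : ∀ G, ¬ IsDecomposable G → π G = 0) :
    ∑ J : JunctionTree V, target π J = ∑ G, π G := by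
  classical
  rw [← Finset.sum_fiberwise _ (fun J : JunctionTree V => J.tree.graph)]
  refine Finset.sum_congr rfl fun G _ => ?_
  rw [Finset.sum_congr rfl fun J hJ => show target π J = π G / numJunctionTrees G by
    rw [target, (Finset.mem_filter.1 hJ).2], Finset.sum_const, nsmul_eq_mul]
  by_cases hG : IsDecomposable G
  · have h : ((Finset.univ.filter fun J : JunctionTree V => J.tree.graph = G).card : ℝ) =
        numJunctionTrees G := by
      rw [numJunctionTrees_eq, Nat.card_eq_fintype_card, Fintype.card_subtype]
    rw [h, mul_div_cancel₀]
    exact Nat.cast_ne_zero.2 (numJunctionTrees_pos hG).ne'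
  · simp [hπ G hG]

end Target

/-! ### The connect move and its reversal -/

section ConnectMove

variable {V : Type*}

theorem CliqueTree.Linked.congr {T : CliqueTree V} {Q Q' : Finset V → Prop} (h : T.Linked Q)
    (hQ : ∀ C, Q' C ↔ Q C) : T.Linked Q' := by
  rwa [show Q' = Q from funext fun C => propext (hQ C)]

/-- When a connect move enlarges a node, the subtree of each vertex gained extends to that node
across a link. -/
theorem CliqueTree.Linked.or_eq {T : CliqueTree V} {Q : Finset V → Prop} (h : T.Linked Q) {A B : Finset V}
    (hA : A ∈ T.nodes) (hQA : Q A) (hAB : T.links.Adj A B) : T.Linked fun C => Q C ∨ C = B := by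
  have key : ∀ C ∈ T.nodes, (Q C ∨ C = B) → Relation.ReflTransGen
      (fun D E => T.links.Adj D E ∧ (Q D ∨ D = B) ∧ (Q E ∨ E = B)) A C := by
    rintro C hC (hQC | rfl)
    · exact Relation.ReflTransGen.mono (fun D E hDE => ⟨hDE.1, Or.inl hDE.2.1, Or.inl hDE.2.2⟩) _ _
        (h A hA C hC hQA hQC)
    · exact .single ⟨hAB, Or.inl hQA, Or.inr rfl⟩
  exact fun C hC D hD hQC hQD => (reflTransGen_adj_symm (key C hC hQC)).trans (key D hD hQD)

variable [DecidableEq V]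

namespace CliqueTree

namespace IsJunctionTreeOf

variable {T : CliqueTree V} {G : SimpleGraph V}

theorem not_subset_of_link (hT : T.IsJunctionTreeOf G) {A B : Finset V} (h : T.links.Adj A B) :
    ¬ A ⊆ B := fun hAB =>
  h.ne (((hT.mem_nodes_iff A).1 (hT.mem_of_link A B h).1).eq_of_le
    ((hT.mem_nodes_iff B).1 (hT.mem_of_link A B h).2).1 hAB)

theorem exists_mem_node [Finite V] (hT : T.IsJunctionTreeOf G) (v : V) : ∃ C ∈ T.nodes, v ∈ C := by
  obtain ⟨C, hvC, hC⟩ := exists_isMaxClique_of_isClique (G := G) (K := {v}) (by simp)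
  exact ⟨C, (hT.mem_nodes_iff C).2 hC, hvC (by simp)⟩

theorem inter_subset_of_link_of_link (hT : T.IsJunctionTreeOf G) {A B C : Finset V}
    (hAB : T.links.Adj A B) (hBC : T.links.Adj B C) (hne : A ≠ C) : A ∩ C ⊆ B :=
  hT.junction A (hT.mem_of_link A B hAB).1 C (hT.mem_of_link B C hBC).2
    (.cons hAB (.cons hBC .nil)) (by simp [hAB.ne, hBC.ne, hne]) B (by simp)

theorem not_triangle [Finite V] (hT : T.IsJunctionTreeOf G) {A B C : Finset V}
    (hAB : T.links.Adj A B) (hBC : T.links.Adj B C) (hAC : T.links.Adj A C) : False := by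
  have := hT.isIntersectionTree.path_unique (hT.mem_of_link A B hAB).1
    (p := .cons hAB (.cons hBC .nil)) (q := .cons hAC .nil)
    (by simp [hAB.ne, hBC.ne, hAC.ne]) (by simp [hAC.ne])
  simpa using congrArg SimpleGraph.Walk.length this

/-- Consider the path from `D` to `A`. If it passes `B`, then `x ∈ B`; otherwise it extends to a
path to `B` through `A`, and then `y ∈ A`. Hence connecting `x` and `y` creates an edge that was
absent. -/
theorem not_mem_of_mem_sdiff [Finite V] (hT : T.IsJunctionTreeOf G) {A B D : Finset V}
    (hAB : T.links.Adj A B) (hD : D ∈ T.nodes) {x y : V} (hx : x ∈ A \ B) (hy : y ∈ B \ A)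
    (hxD : x ∈ D) : y ∉ D := by
  intro hyD
  rw [Finset.mem_sdiff] at hx hy
  obtain ⟨p, -⟩ := exists_walk_of_reflTransGen
    (hT.isIntersectionTree.connected D hD A (hT.mem_of_link A B hAB).1 trivial trivial) trivial
  have hp := p.bypass_isPath
  generalize p.bypass = q at hp
  by_cases hB : B ∈ q.support
  · exact hx.2 (hT.isIntersectionTree.junction hD q hp hB (Finset.mem_inter.2 ⟨hxD, hx.1⟩))
  · exact hy.2 (hT.isIntersectionTree.junction hD _ (hp.concat hB hAB) (by simp)
      (Finset.mem_inter.2 ⟨hyD, hy.1⟩))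

end IsJunctionTreeOf

/-! #### Relabelling nodes -/

theorem relabel_adj {T : CliqueTree V} {f : Finset V → Finset V} {A B : Finset V} :
    (T.relabel f).links.Adj A B ↔ A ≠ B ∧ ∃ C D, T.links.Adj C D ∧ f C = A ∧ f D = B := by
  simp only [relabel, SimpleGraph.fromRel_adj]
  refine and_congr_right fun _ => ⟨?_, Or.inl⟩
  rintro (h | ⟨C, D, h, hC, hD⟩)
  · exact h
  · exact ⟨D, C, h.symm, hD, hC⟩

theorem Linked.relabel {T : CliqueTree V} {f : Finset V → Finset V} {Q : Finset V → Prop}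
    (h : T.Linked fun C => Q (f C)) : (T.relabel f).Linked Q := by
  intro A hA B hB hQA hQB
  obtain ⟨C, hC, rfl⟩ := Finset.mem_image.1 hA
  obtain ⟨D, hD, rfl⟩ := Finset.mem_image.1 hB
  have := h C hC D hD hQA hQB
  clear hB hD hQB
  induction this with
  | refl => exact .refl
  | @tail A B _ hAB ih =>
    by_cases he : f A = f B
    · exact he ▸ ih
    · exact ih.tail ⟨relabel_adj.2 ⟨he, A, B, hAB.1, rfl, rfl⟩, hAB.2⟩

/-- `E` bounds the links that survive. It is the set of all links when one node is replaced, and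
omits the contracted link when two nodes are merged. -/
theorem IsIntersectionTree.relabel [Finite V] {T : CliqueTree V} (hT : T.IsIntersectionTree)
    {f : Finset V → Finset V} (hf : ∀ v, T.Linked fun C => v ∈ f C) (E : Set (Sym2 (Finset V)))
    (hE : ∀ A B, T.links.Adj A B → f A ≠ f B → s(A, B) ∈ E)
    (hcard : E.ncard + 1 ≤ (T.nodes.image f).card) : (T.relabel f).IsIntersectionTree := by
  refine ⟨hT.nonempty.image f, fun {A B} hAB => ?_, hT.connected.relabel (Q := fun _ => True),
    fun v => (hf v).relabel, ?_⟩
  · obtain ⟨-, C, D, hCD, rfl, rfl⟩ := relabel_adj.1 hAB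
    exact Finset.mem_image_of_mem f (hT.mem_of_link hCD)
  · refine le_trans (Nat.succ_le_succ ?_) hcard
    refine (Set.ncard_le_ncard ?_ (Set.toFinite _)).trans (Set.ncard_image_le (f := Sym2.map f))
    intro e he
    induction e with | _ A B
    obtain ⟨hne, C, D, hCD, rfl, rfl⟩ := relabel_adj.1 he
    exact ⟨s(C, D), hE C D hCD hne, rfl⟩

theorem relabel_relabel_cancel {T : CliqueTree V}
    (hT : ∀ {C D}, T.links.Adj C D → C ∈ T.nodes) {f g : Finset V → Finset V}
    (h : ∀ C ∈ T.nodes, g (f C) = C) : (T.relabel f).relabel g = T := by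
  refine CliqueTree.ext ?_ ?_
  · simp only [relabel, Finset.image_image]
    exact (Finset.image_congr fun C hC => h C hC).trans Finset.image_id'
  · ext A B
    rw [relabel_adj]
    constructor
    · rintro ⟨-, C, D, hCD, rfl, rfl⟩
      obtain ⟨-, C', D', h', rfl, rfl⟩ := relabel_adj.1 hCD
      rwa [h _ (hT h'), h _ (hT h'.symm)]
    · intro hAB
      have hA := h A (hT hAB)
      have hB := h B (hT hAB.symm)
      refine ⟨hAB.ne, f A, f B, relabel_adj.2 ⟨fun e => hAB.ne ?_, A, B, hAB, rfl, rfl⟩, hA, hB⟩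
      rw [← hA, e, hB]

/-! #### Inserting a node in the middle of a link -/

/-- Replace the link between `A` and `B` by a path through a new node `U`. -/
def subdivide (T : CliqueTree V) (A B U : Finset V) : CliqueTree V where
  nodes := insert U T.nodes
  links := T.links.deleteEdges {s(A, B)} ⊔ (SimpleGraph.edge A U ⊔ SimpleGraph.edge U B)

theorem subdivide_adj {T : CliqueTree V} {A B U : Finset V} (hA : A ≠ U) (hB : B ≠ U)
    {C D : Finset V} : (T.subdivide A B U).links.Adj C D ↔
      (T.links.Adj C D ∧ ¬ (A = C ∧ B = D) ∧ ¬ (A = D ∧ B = C)) ∨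
        (C = U ∧ (D = A ∨ D = B)) ∨ (D = U ∧ (C = A ∨ C = B)) := by
  simp only [subdivide, SimpleGraph.sup_adj, SimpleGraph.deleteEdges_adj, SimpleGraph.edge_adj,
    Set.mem_singleton_iff, Sym2.eq_iff]
  grind

/-- Since `A ∩ B ⊆ U`, a chain crossing the old link can detour through `U`; since `U ⊆ A ∪ B`,
every vertex of `U` lies in an end linked to `U`. One link is lost and two are gained. -/
theorem IsIntersectionTree.subdivide [Finite V] {T : CliqueTree V} (hT : T.IsIntersectionTree)
    {A B U : Finset V} (hAB : T.links.Adj A B) (hU : U ∉ T.nodes) (h1 : A ∩ B ⊆ U)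
    (h2 : U ⊆ A ∪ B) : (T.subdivide A B U).IsIntersectionTree := by
  have hAm := hT.mem_of_link hAB
  have hBm := hT.mem_of_link hAB.symm
  have hA : A ≠ U := fun e => hU (e ▸ hAm)
  have hB : B ≠ U := fun e => hU (e ▸ hBm)
  have hAU : (T.subdivide A B U).links.Adj A U := (subdivide_adj hA hB).2 (by simp)
  have hUB : (T.subdivide A B U).links.Adj U B := (subdivide_adj hA hB).2 (by simp)
  have hlift : ∀ {Q : Finset V → Prop}, (Q A → Q B → Q U) → T.Linked Q →
      ∀ C ∈ T.nodes, ∀ D ∈ T.nodes, Q C → Q D → Relation.ReflTransGen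
        (fun C D => (T.subdivide A B U).links.Adj C D ∧ Q C ∧ Q D) C D := by
    intro Q hQU hQ C hC D hD hQC hQD
    have h := hQ C hC D hD hQC hQD
    clear hD hQD
    induction h with
    | refl => exact .refl
    | @tail E F _ h ih =>
      by_cases he : A = E ∧ B = F
      · obtain ⟨rfl, rfl⟩ := he
        have hQU := hQU h.2.1 h.2.2
        exact (ih.tail ⟨hAU, h.2.1, hQU⟩).tail ⟨hUB, hQU, h.2.2⟩
      by_cases he' : A = F ∧ B = E
      · obtain ⟨rfl, rfl⟩ := he'
        have hQU := hQU h.2.2 h.2.1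
        exact (ih.tail ⟨hUB.symm, h.2.1, hQU⟩).tail ⟨hAU.symm, hQU, h.2.2⟩
      · exact ih.tail ⟨(subdivide_adj hA hB).2 (Or.inl ⟨h.1, he, he'⟩), h.2⟩
  refine ⟨Finset.insert_nonempty _ _, fun {C D} h => ?_,
    .insert rfl (hlift (fun _ _ => trivial) hT.connected) fun _ _ _ _ => ⟨A, hAm, hAU, trivial⟩,
    fun v => .insert rfl (hlift (fun hA hB => h1 (Finset.mem_inter.2 ⟨hA, hB⟩)) (hT.linked v))
      fun D hD hvD hvU => ?_, ?_⟩
  · rcases (subdivide_adj hA hB).1 h with h | ⟨rfl, -⟩ | ⟨-, rfl | rfl⟩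
    · exact Finset.mem_insert_of_mem (hT.mem_of_link h.1)
    · exact Finset.mem_insert_self _ _
    · exact Finset.mem_insert_of_mem hAm
    · exact Finset.mem_insert_of_mem hBm
  · rcases Finset.mem_union.1 (h2 hvU) with h | h
    · exact ⟨A, hAm, hAU, h⟩
    · exact ⟨B, hBm, hUB.symm, h⟩
  · have h1 := hT.card_le
    have h2 := Set.ncard_sdiff_singleton_add_one (s := T.links.edgeSet)
      ((SimpleGraph.mem_edgeSet _).2 hAB) (Set.toFinite _)
    have h3 : (T.subdivide A B U).links.edgeSet.ncard ≤
        (T.links.edgeSet \ {s(A, B)}).ncard + (1 + 1) := by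
      simp only [CliqueTree.subdivide, SimpleGraph.edgeSet_sup, SimpleGraph.edgeSet_deleteEdges,
        SimpleGraph.edgeSet_edge_of_ne hA, SimpleGraph.edgeSet_edge_of_ne hB.symm]
      refine (Set.ncard_union_le _ _).trans (Nat.add_le_add_left ?_ _)
      exact (Set.ncard_union_le _ _).trans (by simp)
    have h4 : (T.subdivide A B U).nodes.card = T.nodes.card + 1 :=
      Finset.card_insert_of_notMem hU
    omega

/-! #### The three kinds of connect moves -/

/-- `X` and `Y` are admissible choices for a connect move at the link between `A` and `B` of the
junction tree `T`. -/
structure IsConnectMove (T : CliqueTree V) (A B X Y : Finset V) : Prop where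
  isJunctionTreeOf : T.IsJunctionTreeOf T.graph
  link : T.links.Adj A B
  left_subset : X ⊆ A \ B
  left_nonempty : X.Nonempty
  right_subset : Y ⊆ B \ A
  right_nonempty : Y.Nonempty

namespace IsConnectMove

variable {T : CliqueTree V} {A B X Y : Finset V}

theorem symm (h : T.IsConnectMove A B X Y) : T.IsConnectMove B A Y X :=
  ⟨h.isJunctionTreeOf, h.link.symm, h.right_subset, h.right_nonempty, h.left_subset,
    h.left_nonempty⟩

theorem sdiff_union (h : T.IsConnectMove A B X Y) : (X ∪ Y ∪ A ∩ B) \ (X ∪ Y) = A ∩ B := by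
  have := h.left_subset
  have := h.right_subset
  grind

theorem new_subset (h : T.IsConnectMove A B X Y) : X ∪ Y ∪ A ∩ B ⊆ A ∪ B := by
  have := h.left_subset
  have := h.right_subset
  grind

/-- A further neighbour of `A` does not meet `Y`. -/
theorem not_meets (h : T.IsConnectMove A B X Y) {D : Finset V} (hD : T.links.Adj A D)
    (hne : D ≠ B) : ¬ (D ∩ Y).Nonempty := by
  rintro ⟨v, hv⟩
  rw [Finset.mem_inter] at hv
  have hvB := Finset.mem_sdiff.1 (h.right_subset hv.2)
  exact hvB.2 (h.isJunctionTreeOf.inter_subset_of_link_of_link hD.symm h.link hne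
    (Finset.mem_inter.2 ⟨hv.1, hvB.1⟩))

variable [Finite V]

theorem notMem_nodes (h : T.IsConnectMove A B X Y) : X ∪ Y ∪ A ∩ B ∉ T.nodes := by
  obtain ⟨x, hx⟩ := h.left_nonempty
  obtain ⟨y, hy⟩ := h.right_nonempty
  exact fun hU => h.isJunctionTreeOf.not_mem_of_mem_sdiff h.link hU (h.left_subset hx)
    (h.right_subset hy) (by simp [hx]) (by simp [hy])

end IsConnectMove

end CliqueTree

end ConnectMove

/-! ### Connect moves give junction trees and are undone by disconnect moves. -/

section ConnectResult

variable {V : Type*}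

theorem CliqueTree.mem_nbrs {T : CliqueTree V} (hT : ∀ {C D}, T.links.Adj C D → C ∈ T.nodes)
    {C D : Finset V} : D ∈ T.nbrs C ↔ T.links.Adj C D := by
  simp only [CliqueTree.nbrs, Finset.mem_filter, and_iff_right_iff_imp]
  exact fun h => hT h.symm

variable [DecidableEq V]

namespace CliqueTree

/-- `K` is a junction tree with `U` as a node from which `T` is recovered by a disconnect move
separating `X` from `Y`; every node of `T` is contained in a node of `K`. -/
structure IsReversibleExtension (T K : CliqueTree V) (U X Y : Finset V) : Prop where
  isIntersectionTree : K.IsIntersectionTree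
  not_subset : ∀ C D, K.links.Adj C D → ¬ C ⊆ D
  mem_nodes : U ∈ K.nodes
  exists_superset : ∀ C ∈ T.nodes, ∃ D ∈ K.nodes, C ⊆ D
  disconnect_eq : ∃ A ⊆ K.nbrsAvoiding U X Y, K.disconnect U X Y A = some T

namespace IsConnectMove

variable [Finite V] {T : CliqueTree V} {A B X Y : Finset V}

/-- The new node has exactly the neighbours `A`, meeting only `X`, and `B`, meeting only `Y`. Thus
disconnect case (d) applies and deletes it. -/
theorem subdivide (h : T.IsConnectMove A B X Y) (hA : A ≠ X ∪ A ∩ B) (hB : B ≠ Y ∪ A ∩ B) :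
    T.IsReversibleExtension (T.subdivide A B (X ∪ Y ∪ A ∩ B)) (X ∪ Y ∪ A ∩ B) X Y := by
  have hU := h.notMem_nodes
  have hsd := h.sdiff_union
  have hUsub := h.new_subset
  have hXU : X ∪ A ∩ B ⊆ X ∪ Y ∪ A ∩ B := by grind
  have hYU : Y ∪ A ∩ B ⊆ X ∪ Y ∪ A ∩ B := by grind
  have hX := h.left_subset
  have hY := h.right_subset
  obtain ⟨x, hx⟩ := h.left_nonempty
  obtain ⟨y, hy⟩ := h.right_nonempty
  have hxA := Finset.mem_sdiff.1 (hX hx)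
  have hyB := Finset.mem_sdiff.1 (hY hy)
  have hxU : x ∈ X ∪ Y ∪ A ∩ B := by simp [hx]
  have hyU : y ∈ X ∪ Y ∪ A ∩ B := by simp [hy]
  have hAU : ¬ A ⊆ X ∪ Y ∪ A ∩ B := fun hs => hA (by grind)
  have hBU : ¬ B ⊆ X ∪ Y ∪ A ∩ B := fun hs => hB (by grind)
  have hAm := (h.isJunctionTreeOf.mem_of_link _ _ h.link).1
  have hBm := (h.isJunctionTreeOf.mem_of_link _ _ h.link).2
  have hT := h.isJunctionTreeOf.isIntersectionTree
  have hlink := h.link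
  have hsub : ∀ {C D}, T.links.Adj C D → ¬ C ⊆ D := h.isJunctionTreeOf.not_subset_of_link
  generalize X ∪ Y ∪ A ∩ B = U at *
  have hneA : A ≠ U := fun e => hU (e ▸ hAm)
  have hneB : B ≠ U := fun e => hU (e ▸ hBm)
  have hneAB := hlink.ne
  have hadj := fun C D => subdivide_adj (T := T) hneA hneB (C := C) (D := D)
  have hK := hT.subdivide hlink hU (by grind) hUsub
  have hnbrs : (T.subdivide A B U).nbrs U = {A, B} := by
    ext D
    rw [mem_nbrs hK.mem_of_link, hadj]
    have : ¬ T.links.Adj U D := fun h => hU (hT.mem_of_link h)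
    simp [this]
    grind
  have hNX : (T.subdivide A B U).nbrsMeeting U X = {A} := by
    ext D
    simp only [nbrsMeeting, hnbrs, Finset.mem_filter, Finset.mem_insert, Finset.mem_singleton]
    constructor
    · rintro ⟨rfl | rfl, z, hz⟩
      · rfl
      · grind
    · rintro rfl
      exact ⟨Or.inl rfl, x, by grind⟩
  have hNY : (T.subdivide A B U).nbrsMeeting U Y = {B} := by
    ext D
    simp only [nbrsMeeting, hnbrs, Finset.mem_filter, Finset.mem_insert, Finset.mem_singleton]
    constructor
    · rintro ⟨rfl | rfl, z, hz⟩
      · grind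
      · rfl
    · rintro rfl
      exact ⟨Or.inr rfl, y, by grind⟩
  have hN : (T.subdivide A B U).nbrsAvoiding U X Y = ∅ := by
    ext D
    simp only [nbrsAvoiding, hnbrs, Finset.mem_filter, Finset.mem_insert, Finset.mem_singleton,
      Finset.notMem_empty, iff_false]
    rintro ⟨rfl | rfl, h1, h2⟩
    · exact h1 ⟨x, by grind⟩
    · exact h2 ⟨y, by grind⟩
  refine ⟨hK, fun C D hCD => ?_, Finset.mem_insert_self _ _,
    fun C hC => ⟨C, Finset.mem_insert_of_mem hC, subset_rfl⟩, ∅, Finset.empty_subset _, ?_⟩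
  · rcases (hadj C D).1 hCD with h | ⟨rfl, rfl | rfl⟩ | ⟨rfl, rfl | rfl⟩
    · exact hsub h.1
    · exact fun hs => hyB.2 (hs hyU)
    · exact fun hs => hxA.2 (hs hxU)
    · exact hAU
    · exact hBU
  · unfold disconnect
    simp only [hNX, hNY, hN, hsd]
    rw [if_neg (by simp [hneAB]), if_pos ⟨A, by simp, by grind⟩,
      if_pos ⟨B, by simp, by grind⟩, if_pos (by simp), Option.some.injEq]
    refine CliqueTree.ext (Finset.erase_insert hU) ?_
    ext C D
    have h1 : T.links.Adj C D → C ≠ U ∧ D ≠ U ∧ C ≠ D := fun h =>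
      ⟨fun e => hU (e ▸ hT.mem_of_link h), fun e => hU (e ▸ hT.mem_of_link h.symm), h.ne⟩
    have h2 : T.links.Adj D C ↔ T.links.Adj C D := T.links.adj_comm D C
    simp only [SimpleGraph.fromRel_adj, hadj, Finset.mem_singleton]
    have h3 : C = A → D = B → T.links.Adj C D := by rintro rfl rfl; exact hlink
    have h4 : C = B → D = A → T.links.Adj C D := by rintro rfl rfl; exact hlink.symm
    grind

/-- By `not_meets`, `A` is the only neighbour of the enlarged node meeting `X`, and it contains `X ∪
S`. No neighbour meeting `Y` contains `Y ∪ S = B`. So disconnect case (b) restores `B`. -/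
theorem relabel_right (h : T.IsConnectMove A B X Y) (hA : A ≠ X ∪ A ∩ B) (hB : B = Y ∪ A ∩ B) :
    T.IsReversibleExtension (T.relabel fun Z => if Z = B then X ∪ Y ∪ A ∩ B else Z)
      (X ∪ Y ∪ A ∩ B) X Y := by
  have hU := h.notMem_nodes
  have hsd := h.sdiff_union
  have hX := h.left_subset
  have hY := h.right_subset
  obtain ⟨x, hx⟩ := h.left_nonempty
  obtain ⟨y, hy⟩ := h.right_nonempty
  have hxA := Finset.mem_sdiff.1 (hX hx)
  have hyB := Finset.mem_sdiff.1 (hY hy)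
  have hUeq : X ∪ Y ∪ A ∩ B = X ∪ B := by grind
  rw [hUeq] at hU hsd ⊢
  have hAU : ¬ A ⊆ X ∪ B := fun hs => hA (by grind)
  have hAm := (h.isJunctionTreeOf.mem_of_link _ _ h.link).1
  have hBm := (h.isJunctionTreeOf.mem_of_link _ _ h.link).2
  have hT := h.isJunctionTreeOf.isIntersectionTree
  have hsub : ∀ {C D}, T.links.Adj C D → ¬ C ⊆ D := h.isJunctionTreeOf.not_subset_of_link
  set f : Finset V → Finset V := fun Z => if Z = B then X ∪ B else Z with hf
  have hfB : f B = X ∪ B := if_pos rfl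
  have hfne : ∀ {Z}, Z ≠ B → f Z = Z := fun h => if_neg h
  have hfle : ∀ Z, Z ⊆ f Z := fun Z => by grind
  have hne : ∀ {Z}, Z ∈ T.nodes → Z ≠ X ∪ B := fun hZ e => hU (e ▸ hZ)
  have hK : (T.relabel f).IsIntersectionTree := by
    refine hT.relabel (fun v => ?_) T.links.edgeSet (fun _ _ h _ => h) (hT.card_le.trans ?_)
    · by_cases hv : v ∈ X
      · refine ((hT.linked v).or_eq hAm (by grind) h.link).congr fun C => ?_
        grind
      · refine (hT.linked v).congr fun C => ?_
        grind
    · rw [Finset.card_image_of_injOn]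
      intro C hC D hD hCD
      have := hne hC
      have := hne hD
      grind
  have hnbr : ∀ {D}, (T.relabel f).links.Adj (X ∪ B) D ↔ T.links.Adj B D := by
    intro D
    rw [relabel_adj]
    constructor
    · rintro ⟨hne', C, E, hCE, hC, rfl⟩
      have hCB : C = B := by
        by_contra hCB
        exact hne (hT.mem_of_link hCE) (by rw [← hC, hfne hCB])
      subst hCB
      rwa [hfne hCE.ne']
    · intro hBD
      exact ⟨(hne (hT.mem_of_link hBD.symm)).symm, B, D, hBD, hfB, hfne hBD.ne'⟩
  have hmeetX : ∀ {D}, T.links.Adj B D → ((D ∩ X).Nonempty ↔ D = A) := by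
    intro D hD
    refine ⟨fun hDX => by_contra fun hDA => h.symm.not_meets hD hDA hDX, ?_⟩
    rintro rfl
    exact ⟨x, by grind⟩
  have hNX : (T.relabel f).nbrsMeeting (X ∪ B) X = {A} := by
    ext D
    rw [nbrsMeeting, Finset.mem_filter, mem_nbrs hK.mem_of_link, hnbr, Finset.mem_singleton]
    refine ⟨fun hD => (hmeetX hD.1).1 hD.2, ?_⟩
    rintro rfl
    exact ⟨h.link.symm, (hmeetX h.link.symm).2 rfl⟩
  have hNY : ∀ D ∈ (T.relabel f).nbrsMeeting (X ∪ B) Y, T.links.Adj B D ∧ D ≠ A := by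
    intro D hD
    rw [nbrsMeeting, Finset.mem_filter, mem_nbrs hK.mem_of_link, hnbr] at hD
    refine ⟨hD.1, ?_⟩
    rintro rfl
    obtain ⟨z, hz⟩ := hD.2
    grind
  refine ⟨hK, fun C D hKCD => ?_, Finset.mem_image.2 ⟨B, hBm, hfB⟩,
    fun C hC => ⟨f C, Finset.mem_image_of_mem f hC, hfle C⟩, ∅, Finset.empty_subset _, ?_⟩
  · obtain ⟨-, C, D, hCD, rfl, rfl⟩ := relabel_adj.1 hKCD
    by_cases hD : D = B
    · subst hD
      rw [hfB, hfne hCD.ne]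
      -- For another neighbour `C` of `B`, the junction property gives `C ∩ A ⊆ B`, so `C ⊆ X ∪ B`
      -- would force `C ⊆ B`.
      by_cases hC : C = A
      · rwa [hC]
      · intro hs
        have := h.isJunctionTreeOf.inter_subset_of_link_of_link hCD h.link.symm hC
        exact hsub hCD (by grind)
    · rw [hfne hD]
      exact fun hs => hsub hCD ((hfle C).trans hs)
  · unfold disconnect
    simp only [hNX, hsd]
    rw [if_neg, if_pos ⟨A, by simp, by grind⟩, if_neg, if_pos (by simp), Option.some.injEq]
    · refine relabel_relabel_cancel hT.mem_of_link fun C hC => ?_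
      by_cases hCB : C = B
      · rw [hCB, hfB, if_pos rfl, ← hB]
      · rw [hfne hCB, if_neg (hne hC)]
    · rintro ⟨D, hD, hs⟩
      rw [← hB] at hs
      exact hsub (hNY D hD).1 hs
    · rintro ⟨D, hD⟩
      rw [Finset.mem_inter, Finset.mem_singleton] at hD
      exact (hNY D hD.2).2 hD.1

/-- Here `X ∪ S = A` and `Y ∪ S = B`, which no relevant neighbour contains, so disconnect case (a)
applies. The coins must fall so that the neighbours meeting neither `X` nor `Y` return to the end
they were linked to. -/
theorem merge (h : T.IsConnectMove A B X Y) (hA : A = X ∪ A ∩ B) (hB : B = Y ∪ A ∩ B) :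
    T.IsReversibleExtension (T.relabel fun Z => if Z = A ∨ Z = B then X ∪ Y ∪ A ∩ B else Z)
      (X ∪ Y ∪ A ∩ B) X Y := by
  classical
  have hU := h.notMem_nodes
  have hsd := h.sdiff_union
  have hX := h.left_subset
  have hY := h.right_subset
  have hUeq : X ∪ Y ∪ A ∩ B = A ∪ B := by grind
  rw [hUeq] at hU hsd ⊢
  have hlink := h.link
  have hneAB := hlink.ne
  have hAm := (h.isJunctionTreeOf.mem_of_link _ _ h.link).1
  have hBm := (h.isJunctionTreeOf.mem_of_link _ _ h.link).2
  have hT := h.isJunctionTreeOf.isIntersectionTree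
  have hsub : ∀ {C D}, T.links.Adj C D → ¬ C ⊆ D := h.isJunctionTreeOf.not_subset_of_link
  set f : Finset V → Finset V := fun Z => if Z = A ∨ Z = B then A ∪ B else Z with hf
  have hfA : f A = A ∪ B := if_pos (Or.inl rfl)
  have hfB : f B = A ∪ B := if_pos (Or.inr rfl)
  have hfne : ∀ {Z}, Z ≠ A → Z ≠ B → f Z = Z := fun h h' => if_neg (by simp [h, h'])
  have hfle : ∀ Z, Z ⊆ f Z := fun Z => by grind
  have hne : ∀ {Z}, Z ∈ T.nodes → Z ≠ A ∪ B := fun hZ e => hU (e ▸ hZ)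
  have hK : (T.relabel f).IsIntersectionTree := by
    refine hT.relabel (fun v => ?_) (T.links.edgeSet \ {s(A, B)}) (fun C D hCD hfCD => ?_) ?_
    · by_cases hv : v ∈ A
      · refine ((hT.linked v).or_eq hAm hv hlink).congr fun C => ?_
        grind
      by_cases hv' : v ∈ B
      · refine ((hT.linked v).or_eq hBm hv' hlink.symm).congr fun C => ?_
        grind
      · refine (hT.linked v).congr fun C => ?_
        grind
    · refine ⟨hCD, fun e => hfCD ?_⟩
      rcases Sym2.eq_iff.1 (Set.mem_singleton_iff.1 e) with ⟨rfl, rfl⟩ | ⟨rfl, rfl⟩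
      · rw [hfA, hfB]
      · rw [hfA, hfB]
    -- The relabelling is injective on the nodes other than `A`, so at most one node is lost,
    -- balanced by the contracted link.
    · have h1 := Set.ncard_sdiff_singleton_add_one (s := T.links.edgeSet)
        ((SimpleGraph.mem_edgeSet _).2 hlink) (Set.toFinite _)
      have h2 := hT.card_le
      have h3 := Finset.card_erase_add_one hAm
      have h4 : ((T.nodes.erase A).image f).card = (T.nodes.erase A).card := by
        refine Finset.card_image_of_injOn fun C hC D hD hCD => ?_
        have hC := Finset.mem_erase.1 hC
        have hD := Finset.mem_erase.1 hD
        have := hne hC.2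
        have := hne hD.2
        grind
      have h5 := Finset.card_le_card (Finset.image_subset_image (f := f)
        (Finset.erase_subset A T.nodes))
      omega
  have hadj : ∀ {C D}, C ≠ A ∪ B → D ≠ A ∪ B → ((T.relabel f).links.Adj C D ↔
      T.links.Adj C D ∧ C ≠ A ∧ C ≠ B ∧ D ≠ A ∧ D ≠ B) := by
    intro C D hC hD
    rw [relabel_adj]
    constructor
    · rintro ⟨-, E, F, hEF, rfl, rfl⟩
      have h1 : E ≠ A := by rintro rfl; exact hC hfA
      have h2 : E ≠ B := by rintro rfl; exact hC hfB
      have h3 : F ≠ A := by rintro rfl; exact hD hfA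
      have h4 : F ≠ B := by rintro rfl; exact hD hfB
      rw [hfne h1 h2, hfne h3 h4]
      exact ⟨hEF, h1, h2, h3, h4⟩
    · rintro ⟨hCD, h1, h2, h3, h4⟩
      exact ⟨hCD.ne, C, D, hCD, hfne h1 h2, hfne h3 h4⟩
  have hnbr : ∀ {D}, (T.relabel f).links.Adj (A ∪ B) D ↔
      (T.links.Adj A D ∨ T.links.Adj B D) ∧ D ≠ A ∧ D ≠ B := by
    intro D
    rw [relabel_adj]
    constructor
    · rintro ⟨hne', C, E, hCE, hC, rfl⟩
      have h3 : E ≠ A := by rintro rfl; exact hne' hfA.symm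
      have h4 : E ≠ B := by rintro rfl; exact hne' hfB.symm
      rw [hfne h3 h4]
      refine ⟨?_, h3, h4⟩
      by_cases h1 : C = A
      · exact Or.inl (h1 ▸ hCE)
      by_cases h2 : C = B
      · exact Or.inr (h2 ▸ hCE)
      · exact absurd (by rw [← hC, hfne h1 h2]) (hne (hT.mem_of_link hCE))
    · rintro ⟨hD | hD, h3, h4⟩
      · exact ⟨(hne (hT.mem_of_link hD.symm)).symm, A, D, hD, hfA, hfne h3 h4⟩
      · exact ⟨(hne (hT.mem_of_link hD.symm)).symm, B, D, hD, hfB, hfne h3 h4⟩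
  have hNX : ∀ {D}, D ∈ (T.relabel f).nbrsMeeting (A ∪ B) X ↔
      T.links.Adj A D ∧ D ≠ B ∧ (D ∩ X).Nonempty := by
    intro D
    rw [nbrsMeeting, Finset.mem_filter, mem_nbrs hK.mem_of_link, hnbr]
    constructor
    · rintro ⟨⟨hD | hD, h1, h2⟩, hDX⟩
      · exact ⟨hD, h2, hDX⟩
      · exact absurd hDX (h.symm.not_meets hD h1)
    · exact fun ⟨h1, h2, h3⟩ => ⟨⟨Or.inl h1, h1.ne', h2⟩, h3⟩
  have hNY : ∀ {D}, D ∈ (T.relabel f).nbrsMeeting (A ∪ B) Y ↔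
      T.links.Adj B D ∧ D ≠ A ∧ (D ∩ Y).Nonempty := by
    intro D
    rw [nbrsMeeting, Finset.mem_filter, mem_nbrs hK.mem_of_link, hnbr]
    constructor
    · rintro ⟨⟨hD | hD, h1, h2⟩, hDY⟩
      · exact absurd hDY (h.not_meets hD h2)
      · exact ⟨hD, h1, hDY⟩
    · exact fun ⟨h1, h2, h3⟩ => ⟨⟨Or.inr h1, h2, h1.ne'⟩, h3⟩
  have hN : ∀ {D}, D ∈ (T.relabel f).nbrsAvoiding (A ∪ B) X Y ↔
      ((T.links.Adj A D ∨ T.links.Adj B D) ∧ D ≠ A ∧ D ≠ B) ∧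
        ¬ (D ∩ X).Nonempty ∧ ¬ (D ∩ Y).Nonempty := by
    intro D
    rw [nbrsAvoiding, Finset.mem_filter, mem_nbrs hK.mem_of_link, hnbr]
  refine ⟨hK, fun C D hKCD => ?_, Finset.mem_image.2 ⟨B, hBm, hfB⟩,
    fun C hC => ⟨f C, Finset.mem_image_of_mem f hC, hfle C⟩,
    ((T.relabel f).nbrsAvoiding (A ∪ B) X Y).filter fun D => T.links.Adj A D,
    Finset.filter_subset _ _, ?_⟩
  · obtain ⟨hfCD, C, D, hCD, rfl, rfl⟩ := relabel_adj.1 hKCD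
    by_cases hDA : D = A
    · subst hDA
      have hCB : C ≠ B := by rintro rfl; exact hfCD (hfB.trans hfA.symm)
      rw [hfA, hfne hCD.ne hCB]
      intro hs
      have := h.isJunctionTreeOf.inter_subset_of_link_of_link hCD hlink hCB
      exact hsub hCD (by grind)
    by_cases hDB : D = B
    · subst hDB
      have hCA : C ≠ A := by rintro rfl; exact hfCD (hfA.trans hfB.symm)
      rw [hfB, hfne hCA hCD.ne]
      intro hs
      have := h.isJunctionTreeOf.inter_subset_of_link_of_link hCD hlink.symm hCA
      exact hsub hCD (by grind)
    · rw [hfne hDA hDB]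
      exact fun hs => hsub hCD ((hfle C).trans hs)
  · unfold disconnect
    simp only [hsd]
    rw [← hA, ← hB, if_neg, if_neg, if_neg, Option.some.injEq]
    · refine CliqueTree.ext ?_ ?_
      · ext C
        simp only [relabel, Finset.mem_insert, Finset.mem_erase, Finset.mem_image]
        constructor
        · rintro (rfl | rfl | ⟨hC, D, hD, rfl⟩)
          · exact hAm
          · exact hBm
          · have h1 : D ≠ A := by rintro rfl; exact hC hfA
            have h2 : D ≠ B := by rintro rfl; exact hC hfB
            rwa [hfne h1 h2]
        · intro hC
          by_cases h1 : C = A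
          · exact Or.inl h1
          by_cases h2 : C = B
          · exact Or.inr (Or.inl h2)
          · exact Or.inr (Or.inr ⟨hne hC, C, hC, hfne h1 h2⟩)
      · have hleft : ∀ {E}, E ∈ (T.relabel f).nbrsMeeting (A ∪ B) X ∪
            ((T.relabel f).nbrsAvoiding (A ∪ B) X Y).filter (fun D => T.links.Adj A D) ↔
            T.links.Adj A E ∧ E ≠ B := by
          intro E
          rw [Finset.mem_union, hNX, Finset.mem_filter, hN]
          constructor
          · rintro (h1 | h1)
            · exact ⟨h1.1, h1.2.1⟩
            · exact ⟨h1.2, h1.1.1.2.2⟩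
          · intro h1
            by_cases h2 : (E ∩ X).Nonempty
            · exact Or.inl ⟨h1.1, h1.2, h2⟩
            · exact Or.inr ⟨⟨⟨Or.inl h1.1, h1.1.ne', h1.2⟩, h2, h.not_meets h1.1 h1.2⟩, h1.1⟩
        have hright : ∀ {E}, E ∈ (T.relabel f).nbrsMeeting (A ∪ B) Y ∪
            ((T.relabel f).nbrsAvoiding (A ∪ B) X Y \
              ((T.relabel f).nbrsAvoiding (A ∪ B) X Y).filter (fun D => T.links.Adj A D)) ↔
            T.links.Adj B E ∧ E ≠ A := by
          intro E
          rw [Finset.mem_union, hNY, Finset.mem_sdiff, Finset.mem_filter, hN]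
          constructor
          · rintro (h1 | h1)
            · exact ⟨h1.1, h1.2.1⟩
            · exact ⟨h1.1.1.1.resolve_left fun h2 => h1.2 ⟨h1.1, h2⟩, h1.1.1.2.1⟩
          · intro h1
            -- In a tree, no neighbour of `B` is also a neighbour of `A`, so the coin set does not
            -- claim it.
            have h3 : ¬ T.links.Adj A E := fun h3 =>
              h.isJunctionTreeOf.not_triangle hlink h1.1 h3
            by_cases h2 : (E ∩ Y).Nonempty
            · exact Or.inl ⟨h1.1, h1.2, h2⟩
            · exact Or.inr ⟨⟨⟨Or.inr h1.1, h1.2, h1.1.ne'⟩, h.symm.not_meets h1.1 h1.2, h2⟩,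
                fun h4 => h3 h4.2⟩
        ext C D
        simp only [SimpleGraph.fromRel_adj, hleft, hright]
        have h4 : T.links.Adj C D → C ≠ D ∧ C ≠ A ∪ B ∧ D ≠ A ∪ B := fun h =>
          ⟨h.ne, hne (hT.mem_of_link h), hne (hT.mem_of_link h.symm)⟩
        have h5 : T.links.Adj B A := hlink.symm
        constructor
        · rintro ⟨-, (h6 | h6 | h6 | h6) | h6 | h6 | h6 | h6⟩
          · exact ((hadj h6.2.1 h6.2.2).1 h6.1).1
          · rw [h6.1, h6.2]; exact hlink
          · rw [h6.1]; exact h6.2.1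
          · rw [h6.1]; exact h6.2.1
          · exact ((hadj h6.2.1 h6.2.2).1 h6.1).1.symm
          · rw [h6.1, h6.2]; exact h5
          · rw [h6.1]; exact h6.2.1.symm
          · rw [h6.1]; exact h6.2.1.symm
        · intro hCD
          have h6 := h4 hCD
          refine ⟨h6.1, ?_⟩
          by_cases hCA : C = A
          · subst hCA
            by_cases hDB : D = B
            · exact Or.inl (Or.inr (Or.inl ⟨rfl, hDB⟩))
            · exact Or.inl (Or.inr (Or.inr (Or.inl ⟨rfl, hCD, hDB⟩)))
          by_cases hCB : C = B
          · subst hCB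
            by_cases hDA : D = A
            · exact Or.inr (Or.inr (Or.inl ⟨hDA, rfl⟩))
            · exact Or.inl (Or.inr (Or.inr (Or.inr ⟨rfl, hCD, hDA⟩)))
          by_cases hDA : D = A
          · subst hDA
            exact Or.inr (Or.inr (Or.inr (Or.inl ⟨rfl, hCD.symm, hCB⟩)))
          by_cases hDB : D = B
          · subst hDB
            exact Or.inr (Or.inr (Or.inr (Or.inr ⟨rfl, hCD.symm, hCA⟩)))
          · exact Or.inl (Or.inl ⟨(hadj h6.2.1 h6.2.2).2 ⟨hCD, hCA, hCB, hDA, hDB⟩, h6.2⟩)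
    · rintro ⟨D, hD, hs⟩
      exact hsub (hNY.1 hD).1 hs
    · rintro ⟨D, hD, hs⟩
      exact hsub (hNX.1 hD).1 hs
    · rintro ⟨D, hD⟩
      rw [Finset.mem_inter, hNX, hNY] at hD
      exact h.not_meets hD.1.1 hD.1.2.1 hD.2.2.2

/-- `hAB` excludes only connect case (c), which is case (b) with the ends exchanged. -/
theorem connect (h : T.IsConnectMove A B X Y) (hAB : A = X ∪ A ∩ B → B = Y ∪ A ∩ B) :
    T.IsReversibleExtension (T.connect A B X Y) (X ∪ Y ∪ A ∩ B) X Y := by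
  unfold CliqueTree.connect
  by_cases hA : A = X ∪ A ∩ B
  · simp only [if_pos hA, if_pos (hAB hA)]
    exact h.merge hA (hAB hA)
  by_cases hB : B = Y ∪ A ∩ B
  · simp only [if_neg hA, if_pos hB]
    exact h.relabel_right hA hB
  · simp only [if_neg hA, if_neg hB]
    exact h.subdivide hA hB

end IsConnectMove

end CliqueTree

end ConnectResult

/-! ### The proposal probabilities -/

section Laws

variable {V : Type*} {m : MoveType}

theorem connectLaw_nonneg (B X : Finset V) : 0 ≤ connectLaw m B X := by
  cases m <;> simp only [connectLaw] <;> positivity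

theorem connectLaw_singleton_pos {B : Finset V} {x : V} (hx : x ∈ B) : 0 < connectLaw m B {x} := by
  have : 0 < B.card := Finset.card_pos.2 ⟨x, hx⟩
  cases m
  · simp only [connectLaw, Finset.card_singleton, if_true]
    positivity
  · simp only [connectLaw, Finset.card_singleton, Finset.singleton_nonempty, if_true,
      Nat.choose_one_right]
    positivity

/-- Grouping by size, each admissible size cancels its binomial coefficient. The sum is 0 for empty
`B`, whence only `≤`. -/
theorem sum_connectLaw_le_one (B : Finset V) : ∑ X ∈ B.powerset, connectLaw m B X ≤ 1 := by
  cases m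
  · simp only [connectLaw]
    rw [Finset.sum_powerset_apply_card (fun k => if k = 1 then 1 / (B.card : ℝ) else 0)]
    simp only [smul_ite, smul_zero, Finset.sum_ite_eq', Finset.mem_range]
    split_ifs
    · rw [Nat.choose_one_right, nsmul_eq_mul, mul_one_div]
      exact div_self_le_one _
    · exact zero_le_one
  · simp only [connectLaw, ← Finset.card_pos]
    rw [Finset.sum_powerset_apply_card
      (fun k => if 0 < k then 1 / (B.card : ℝ) * (1 / (B.card.choose k : ℝ)) else 0),
      Finset.sum_range_succ']
    simp only [lt_irrefl, if_false, smul_zero, add_zero, Nat.succ_pos, if_true]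
    rw [Finset.sum_congr rfl fun k hk => show _ = 1 / (B.card : ℝ) by
      have : 0 < B.card.choose (k + 1) := Nat.choose_pos (Finset.mem_range.1 hk)
      rw [nsmul_eq_mul]
      field_simp]
    rw [Finset.sum_const, Finset.card_range, nsmul_eq_mul, mul_one_div]
    exact div_self_le_one _

theorem disconnectLaw_nonneg {C X Y : Finset V} (hX : X ⊆ C) :
    0 ≤ disconnectLaw m C X Y := by
  cases m
  · simp only [disconnectLaw]
    split_ifs with h
    · have : (1 : ℝ) ≤ C.card := by
        exact_mod_cast h.1 ▸ Finset.card_le_card hX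
      have : (0 : ℝ) ≤ (C.card : ℝ) - 1 := by linarith
      positivity
    · rfl
  · simp only [disconnectLaw]
    split_ifs with h
    · have h1 : (1 : ℝ) ≤ X.card := by exact_mod_cast h.1.card_pos
      have h2 : (1 : ℝ) ≤ Y.card := by exact_mod_cast h.2.card_pos
      have h3 : (X.card : ℝ) ≤ C.card := by exact_mod_cast Finset.card_le_card hX
      have h4 : (0 : ℝ) ≤ (C.card : ℝ) - 1 := by linarith
      have h5 : (0 : ℝ) ≤ (X.card : ℝ) + Y.card - 1 := by linarith
      positivity
    · rfl

theorem disconnectLaw_singleton_pos {C : Finset V} {x y : V} (hx : x ∈ C) (hy : y ∈ C)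
    (hne : x ≠ y) : 0 < disconnectLaw m C {x} {y} := by
  have h : 1 < C.card := Finset.one_lt_card.2 ⟨x, hx, y, hy, hne⟩
  have h1 : (1 : ℝ) < C.card := by exact_mod_cast h
  have h2 : (0 : ℝ) < (C.card : ℝ) - 1 := by linarith
  cases m
  · simp only [disconnectLaw, Finset.card_singleton, and_self, if_true]
    positivity
  · simp only [disconnectLaw, Finset.card_singleton, Finset.singleton_nonempty, and_self, if_true]
    norm_num
    positivity

variable [DecidableEq V]

theorem sum_disconnectLaw_le_one (C : Finset V) :
    ∑ X ∈ C.powerset, ∑ Y ∈ (C \ X).powerset, disconnectLaw m C X Y ≤ 1 := by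
  cases m
  · have hinner : ∀ X ∈ C.powerset, ∑ Y ∈ (C \ X).powerset, disconnectLaw .single C X Y ≤
        if X.card = 1 then 1 / (C.card : ℝ) else 0 := by
      intro X hX
      have hXC := Finset.card_le_card (Finset.mem_powerset.1 hX)
      simp only [disconnectLaw]
      by_cases h : X.card = 1
      · simp only [h, true_and, if_true]
        rw [Finset.sum_powerset_apply_card
          (fun k => if k = 1 then 1 / ((C.card : ℝ) * ((C.card : ℝ) - 1)) else 0)]
        simp only [smul_ite, smul_zero, Finset.sum_ite_eq', Finset.mem_range]
        split_ifs with h1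
        · rw [Finset.card_sdiff_of_subset (Finset.mem_powerset.1 hX), h] at h1
          have h2 : (1 : ℝ) < C.card := by exact_mod_cast (by omega : 1 < C.card)
          have h3 : (C.card : ℝ) - 1 ≠ 0 := by linarith
          rw [Nat.choose_one_right, nsmul_eq_mul,
            Finset.card_sdiff_of_subset (Finset.mem_powerset.1 hX), h, Nat.cast_sub (by omega)]
          refine le_of_eq ?_
          push_cast
          field_simp
        · positivity
      · simp [h]
    refine (Finset.sum_le_sum hinner).trans ?_
    exact sum_connectLaw_le_one (m := .single) C
  · set c := C.card with hc
    -- The number of pairs `(X, Y)` with sizes `a`, `b` is a multinomial coefficient, cancelled by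
    -- the factorials in the law.
    have hsum : ∑ X ∈ C.powerset, ∑ Y ∈ (C \ X).powerset, disconnectLaw .multiple C X Y =
        ∑ a ∈ Finset.range (c + 1), ∑ b ∈ Finset.range (c + 1 - a),
          if 0 < a ∧ 0 < b then 1 / ((c : ℝ) - 1) * (1 / ((a : ℝ) + b - 1)) else 0 := by
      have h1 : ∀ X ∈ C.powerset, ∑ Y ∈ (C \ X).powerset, disconnectLaw .multiple C X Y =
          ∑ b ∈ Finset.range (c - X.card + 1), (c - X.card).choose b •
            (if 0 < X.card ∧ 0 < b then 1 / ((c : ℝ) - 1) * (1 / ((X.card : ℝ) + (b : ℝ) - 1)) *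
              ((X.card.factorial : ℝ) * (b.factorial : ℝ) *
                ((c - (X.card + b)).factorial : ℝ) / (c.factorial : ℝ)) else 0) := by
        intro X hX
        simp only [disconnectLaw, ← Finset.card_pos, ← hc]
        rw [Finset.sum_powerset_apply_card (fun b =>
          if 0 < X.card ∧ 0 < b then 1 / ((c : ℝ) - 1) * (1 / ((X.card : ℝ) + (b : ℝ) - 1)) *
              ((X.card.factorial : ℝ) * (b.factorial : ℝ) *
                ((c - (X.card + b)).factorial : ℝ) / (c.factorial : ℝ)) else 0),
          Finset.card_sdiff_of_subset (Finset.mem_powerset.1 hX)]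
      rw [Finset.sum_congr rfl h1, Finset.sum_powerset_apply_card (fun a =>
        ∑ b ∈ Finset.range (c - a + 1), (c - a).choose b •
            (if 0 < a ∧ 0 < b then 1 / ((c : ℝ) - 1) * (1 / ((a : ℝ) + (b : ℝ) - 1)) *
              ((a.factorial : ℝ) * (b.factorial : ℝ) *
                ((c - (a + b)).factorial : ℝ) / (c.factorial : ℝ)) else 0)), ← hc]
      refine Finset.sum_congr rfl fun a ha => ?_
      have ha := Finset.mem_range.1 ha
      rw [show c + 1 - a = c - a + 1 by omega, Finset.smul_sum]
      refine Finset.sum_congr rfl fun b hb => ?_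
      have hb := Finset.mem_range.1 hb
      have e1 : ((c.choose a : ℕ) : ℝ) * a.factorial * (c - a).factorial = c.factorial := by
        exact_mod_cast Nat.choose_mul_factorial_mul_factorial (by omega : a ≤ c)
      have e2 : (((c - a).choose b : ℕ) : ℝ) * b.factorial * (c - (a + b)).factorial =
          (c - a).factorial := by
        rw [← Nat.sub_sub]
        exact_mod_cast Nat.choose_mul_factorial_mul_factorial (by omega : b ≤ c - a)
      have e3 : (c.factorial : ℝ) ≠ 0 := by positivity
      simp only [nsmul_eq_mul, mul_ite, mul_zero]
      split_ifs with h
      · rw [show (c.choose a : ℝ) * (((c - a).choose b : ℝ) * (1 / ((c : ℝ) - 1) *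
            (1 / ((a : ℝ) + (b : ℝ) - 1)) * ((a.factorial : ℝ) * (b.factorial : ℝ) *
              ((c - (a + b)).factorial : ℝ) / (c.factorial : ℝ)))) =
            1 / ((c : ℝ) - 1) * (1 / ((a : ℝ) + (b : ℝ) - 1)) *
              ((c.choose a : ℝ) * a.factorial * (((c - a).choose b : ℝ) * b.factorial *
                (c - (a + b)).factorial) / c.factorial) by ring, e2, e1, div_self e3, mul_one]
      · rfl
    -- Sum along `M = a + b`: there are `M - 1` choices of `a` for each `M`, and `c - 1` values of
    -- `M`.
    rw [hsum, ← Finset.sum_range_diag_flip (c + 1) (fun a b =>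
      if 0 < a ∧ 0 < b then 1 / ((c : ℝ) - 1) * (1 / ((a : ℝ) + (b : ℝ) - 1)) else 0)]
    have hinner : ∀ M ∈ Finset.range (c + 1), (∑ k ∈ Finset.range (M + 1),
        if 0 < k ∧ 0 < M - k then
          1 / ((c : ℝ) - 1) * (1 / ((k : ℝ) + ((M - k : ℕ) : ℝ) - 1)) else 0) =
        if 2 ≤ M then 1 / ((c : ℝ) - 1) else 0 := by
      intro M hM
      rw [← Finset.sum_filter, Finset.sum_congr rfl fun k hk =>
        show _ = 1 / ((c : ℝ) - 1) * (1 / ((M : ℝ) - 1)) by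
          rw [Nat.cast_sub (by have := (Finset.mem_filter.1 hk).2; omega)]
          ring]
      rw [show (Finset.range (M + 1)).filter (fun k => 0 < k ∧ 0 < M - k) = Finset.Ico 1 M by
        ext k; simp only [Finset.mem_filter, Finset.mem_range, Finset.mem_Ico]; omega,
        Finset.sum_const, Nat.card_Ico, nsmul_eq_mul]
      split_ifs with h
      · have : (2 : ℝ) ≤ M := by exact_mod_cast h
        have : (M : ℝ) - 1 ≠ 0 := by linarith
        rw [Nat.cast_sub (by omega), Nat.cast_one]
        field_simp
      · rw [show M - 1 = 0 by omega]
        simp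
    rw [Finset.sum_congr rfl hinner, ← Finset.sum_filter, Finset.sum_const,
      show (Finset.range (c + 1)).filter (fun M => 2 ≤ M) = Finset.Ico 2 (c + 1) by
        ext k; simp only [Finset.mem_filter, Finset.mem_range, Finset.mem_Ico]; omega,
      Nat.card_Ico, nsmul_eq_mul]
    rcases Nat.lt_or_ge c 2 with h | h
    · rw [show c + 1 - 2 = 0 by omega]
      simp
    · rw [show c + 1 - 2 = c - 1 by omega, Nat.cast_sub (by omega), Nat.cast_one, mul_one_div]
      exact div_self_le_one _

end Laws

/-! ### Nonnegativity, positivity and total mass of the proposals. -/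

section ProposalBounds

variable {V : Type*} [DecidableEq V] {m : MoveType}

theorem connectProb_nonneg (J K : JunctionTree V) : 0 ≤ connectProb m J K := by
  refine Finset.sum_nonneg fun e _ => mul_nonneg (by positivity) (Finset.sum_nonneg fun X _ =>
    Finset.sum_nonneg fun Y _ => mul_nonneg (mul_nonneg (connectLaw_nonneg _ _)
      (connectLaw_nonneg _ _)) (by split_ifs <;> norm_num))

theorem disconnectProb_nonneg (J K : JunctionTree V) : 0 ≤ disconnectProb m J K := by
  refine Finset.sum_nonneg fun C _ => mul_nonneg (by positivity) (Finset.sum_nonneg fun X hX =>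
    Finset.sum_nonneg fun Y _ => mul_nonneg (disconnectLaw_nonneg (Finset.mem_powerset.1 hX)) (Finset.sum_nonneg fun A _ => ?_))
  split_ifs <;> positivity

theorem proposal_nonneg {p : ℝ} (hp0 : 0 < p) (hp1 : p < 1) (J K : JunctionTree V) :
    0 ≤ proposal m p J K :=
  add_nonneg (mul_nonneg hp0.le (connectProb_nonneg J K))
    (mul_nonneg (sub_nonneg.2 hp1.le) (disconnectProb_nonneg J K))

theorem sum_ite_eq_le_one {α β : Type*} [Fintype α] {t : α → β} (ht : Function.Injective t) (b : β)
    [∀ K, Decidable (b = t K)] : ∑ K, (if b = t K then (1 : ℝ) else 0) ≤ 1 := by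
  rw [Finset.sum_boole]
  refine Nat.cast_le_one.2 (Finset.card_le_one.2 fun x hx y hy => ?_)
  rw [Finset.mem_filter] at hx hy
  exact ht (hx.2.symm.trans hy.2)

theorem one_div_card_mul_sum_le_one {α : Type*} (s : Finset α) (f : α → ℝ) (hf : ∀ x ∈ s, f x ≤ 1) :
    1 / (s.card : ℝ) * ∑ x ∈ s, f x ≤ 1 := by
  rw [Finset.mul_sum]
  calc ∑ x ∈ s, 1 / (s.card : ℝ) * f x ≤ ∑ x ∈ s, 1 / (s.card : ℝ) :=
        Finset.sum_le_sum fun x hx => mul_le_of_le_one_right (by positivity) (hf x hx)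
    _ ≤ 1 := by
        rw [Finset.sum_const, nsmul_eq_mul, mul_one_div]
        exact div_self_le_one _

theorem tree_injective : Function.Injective fun K : JunctionTree V => K.tree :=
  fun _ _ h => JunctionTree.ext h

theorem connectProb_pos {J K : JunctionTree V} {A B : Finset V} {x y : V}
    (hAB : J.tree.links.Adj A B) (hx : x ∈ A \ B) (hy : y ∈ B \ A)
    (h : J.tree.connect A B {x} {y} = K.tree) : 0 < connectProb m J K := by
  have hmem : (A, B) ∈ J.tree.orientedLinks := by
    simp only [CliqueTree.orientedLinks, Finset.mem_filter, Finset.mem_product]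
    exact ⟨J.isJunctionTree.mem_of_link A B hAB, hAB⟩
  have hnn : ∀ (e : Finset V × Finset V) (X Y : Finset V), 0 ≤ connectLaw m (e.1 \ e.2) X *
      connectLaw m (e.2 \ e.1) Y :=
    fun e X Y => mul_nonneg (connectLaw_nonneg _ _) (connectLaw_nonneg _ _)
  refine Finset.sum_pos' (fun e _ => mul_nonneg (by positivity) (Finset.sum_nonneg fun X _ =>
    Finset.sum_nonneg fun Y _ => mul_nonneg (hnn _ _ _) (by split_ifs <;> norm_num)))
    ⟨(A, B), hmem, mul_pos ?_ ?_⟩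
  · exact one_div_pos.2 (Nat.cast_pos.2 (Finset.card_pos.2 ⟨_, hmem⟩))
  refine Finset.sum_pos' (fun X _ => Finset.sum_nonneg fun Y _ =>
    mul_nonneg (hnn (A, B) _ _) (by split_ifs <;> norm_num))
    ⟨{x}, by simpa using hx, ?_⟩
  refine Finset.sum_pos' (fun Y _ => mul_nonneg (hnn (A, B) _ _) (by split_ifs <;> norm_num))
    ⟨{y}, by simpa using hy, ?_⟩
  rw [if_pos h, mul_one]
  exact mul_pos (connectLaw_singleton_pos hx) (connectLaw_singleton_pos hy)

open Classical in
theorem disconnectProb_pos {J K : JunctionTree V} {C : Finset V} {x y : V}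
    {A : Finset (Finset V)} (hC : C ∈ J.tree.nodes) (hx : x ∈ C) (hy : y ∈ C) (hne : x ≠ y)
    (hA : A ⊆ J.tree.nbrsAvoiding C {x} {y})
    (h : J.tree.disconnect C {x} {y} A = some K.tree) : 0 < disconnectProb m J K := by
  have hcoin : ∀ C X Y A, (0 : ℝ) ≤ (1 / 2 : ℝ) ^ (J.tree.nbrsAvoiding C X Y).card *
      if J.tree.disconnect C X Y A = some K.tree then 1 else 0 := by
    intro C X Y A
    split_ifs <;> positivity
  refine Finset.sum_pos' (fun C _ => mul_nonneg (by positivity) (Finset.sum_nonneg fun X hX =>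
    Finset.sum_nonneg fun Y _ => mul_nonneg (disconnectLaw_nonneg (Finset.mem_powerset.1 hX)) (Finset.sum_nonneg fun A _ => hcoin _ _ _ _)))
    ⟨C, hC, mul_pos ?_ ?_⟩
  · exact one_div_pos.2 (Nat.cast_pos.2 (Finset.card_pos.2 ⟨_, hC⟩))
  refine Finset.sum_pos' (fun X hX => Finset.sum_nonneg fun Y _ => mul_nonneg
    (disconnectLaw_nonneg (Finset.mem_powerset.1 hX))
      (Finset.sum_nonneg fun A _ => hcoin _ _ _ _)) ⟨{x}, by simpa using hx, ?_⟩
  have hy' : y ∈ C \ {x} := by simp [hy, hne.symm]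
  refine Finset.sum_pos' (fun Y _ => mul_nonneg
    (disconnectLaw_nonneg (by simpa using hx))
      (Finset.sum_nonneg fun A _ => hcoin _ _ _ _)) ⟨{y}, by simpa using hy', ?_⟩
  refine mul_pos (disconnectLaw_singleton_pos hx hy hne)
    (Finset.sum_pos' (fun A _ => hcoin _ _ _ _) ⟨A, Finset.mem_powerset.2 hA, ?_⟩)
  rw [if_pos h]
  positivity

variable [Finite V]

theorem sum_connectProb_le_one (J : JunctionTree V) : ∑ K, connectProb m J K ≤ 1 := by
  classical
  simp only [connectProb]
  rw [Finset.sum_comm]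
  simp only [← Finset.mul_sum]
  refine one_div_card_mul_sum_le_one _ _ fun e _ => ?_
  rw [Finset.sum_comm]
  simp only [fun X => Finset.sum_comm (s := (Finset.univ : Finset (JunctionTree V)))
    (t := (e.2 \ e.1).powerset) (f := fun K Y => connectLaw m (e.1 \ e.2) X *
      connectLaw m (e.2 \ e.1) Y * if J.tree.connect e.1 e.2 X Y = K.tree then (1 : ℝ) else 0),
    ← Finset.mul_sum]
  calc _ ≤ ∑ X ∈ (e.1 \ e.2).powerset, ∑ Y ∈ (e.2 \ e.1).powerset,
        connectLaw m (e.1 \ e.2) X * connectLaw m (e.2 \ e.1) Y :=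
        Finset.sum_le_sum fun X _ => Finset.sum_le_sum fun Y _ =>
          mul_le_of_le_one_right (mul_nonneg (connectLaw_nonneg _ _) (connectLaw_nonneg _ _))
            (sum_ite_eq_le_one tree_injective _)
    _ = (∑ X ∈ (e.1 \ e.2).powerset, connectLaw m (e.1 \ e.2) X) *
        ∑ Y ∈ (e.2 \ e.1).powerset, connectLaw m (e.2 \ e.1) Y := by
        rw [Finset.sum_mul_sum]
    _ ≤ 1 := mul_le_one₀ (sum_connectLaw_le_one _)
        (Finset.sum_nonneg fun _ _ => connectLaw_nonneg _ _) (sum_connectLaw_le_one _)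

/-- Each choice of `C`, `X`, `Y` and coins leads to at most one `K`. An outcome that is not a
junction tree would simply contribute nothing, so validity of every disconnect move is not needed
here. -/
theorem sum_disconnectProb_le_one (J : JunctionTree V) : ∑ K, disconnectProb m J K ≤ 1 := by
  classical
  simp only [disconnectProb]
  rw [Finset.sum_comm]
  simp only [← Finset.mul_sum]
  refine one_div_card_mul_sum_le_one _ _ fun C _ => ?_
  rw [Finset.sum_comm]
  refine le_trans (Finset.sum_le_sum fun X hX => ?_) (sum_disconnectLaw_le_one (m := m) C)
  rw [Finset.sum_comm]
  refine Finset.sum_le_sum fun Y _ => ?_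
  rw [← Finset.mul_sum, ← Finset.mul_sum, Finset.sum_comm]
  refine mul_le_of_le_one_right (disconnectLaw_nonneg (Finset.mem_powerset.1 hX)) ?_
  set n := (J.tree.nbrsAvoiding C X Y).card with hn
  calc _ ≤ (1 / 2 : ℝ) ^ n * ∑ A ∈ (J.tree.nbrsAvoiding C X Y).powerset, 1 := by
        refine mul_le_mul_of_nonneg_left (Finset.sum_le_sum fun A _ => ?_) (by positivity)
        exact sum_ite_eq_le_one (t := fun K : JunctionTree V => some K.tree)
          (fun _ _ h => JunctionTree.ext (Option.some.inj h)) _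
    _ = 1 := by
        rw [Finset.sum_const, Finset.card_powerset, ← hn, nsmul_eq_mul, mul_one]
        push_cast
        rw [← mul_pow]
        norm_num

theorem sum_proposal_le_one {p : ℝ} (hp0 : 0 < p) (hp1 : p < 1) (J : JunctionTree V) :
    ∑ K, proposal m p J K ≤ 1 := by
  simp only [proposal, Finset.sum_add_distrib, ← Finset.mul_sum]
  nlinarith [sum_connectProb_le_one (m := m) J, sum_disconnectProb_le_one (m := m) J]

/-- Without links the connect move, tried with probability `p`, proposes nothing. -/
theorem sum_proposal_lt_one {p : ℝ} (hp0 : 0 < p) (hp1 : p < 1) {J : JunctionTree V}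
    (hJ : ∀ A B, ¬ J.tree.links.Adj A B) : ∑ K, proposal m p J K < 1 := by
  have h0 : ∀ K, connectProb m J K = 0 := fun K => by
    have : J.tree.orientedLinks = ∅ := by
      simp [CliqueTree.orientedLinks, hJ]
    simp [connectProb, this]
  simp only [proposal, h0, mul_zero, zero_add, ← Finset.mul_sum]
  nlinarith [sum_disconnectProb_le_one (m := m) J]

end ProposalBounds

/-! ### Irreducibility -/

section Irreducibility

variable {V : Type*} [DecidableEq V] [Finite V]

/-- From a junction tree with a link, a connect move that can be undone leads to a junction tree
with a larger graph. -/
theorem exists_connect {J : JunctionTree V} {A₀ B₀ : Finset V} (h₀ : J.tree.links.Adj A₀ B₀) :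
    ∃ K : JunctionTree V, J.tree.graph < K.tree.graph ∧
      ∀ m : MoveType, 0 < connectProb m J K ∧ 0 < disconnectProb m K J := by
  obtain ⟨A, B, x, y, hmove, hAB⟩ : ∃ A B x y, J.tree.IsConnectMove A B {x} {y} ∧
      (A = {x} ∪ A ∩ B → B = {y} ∪ A ∩ B) := by
    obtain ⟨x, hx⟩ := Finset.not_subset.1 (J.isJunctionTree.not_subset_of_link h₀)
    obtain ⟨y, hy⟩ := Finset.not_subset.1 (J.isJunctionTree.not_subset_of_link h₀.symm)
    have hmove : J.tree.IsConnectMove A₀ B₀ {x} {y} := ⟨J.isJunctionTree, h₀, by simpa using hx,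
      by simp, by simpa using hy, by simp⟩
    -- If only the first end is exhausted, exchanging the two ends brings the move into a form
    -- covered by `IsConnectMove.connect`.
    by_cases h : A₀ = {x} ∪ A₀ ∩ B₀ → B₀ = {y} ∪ A₀ ∩ B₀
    · exact ⟨A₀, B₀, x, y, hmove, h⟩
    · push Not at h
      refine ⟨B₀, A₀, y, x, hmove.symm, fun h' => ?_⟩
      rw [Finset.inter_comm] at h' ⊢
      exact h.1
  have hx : x ∈ A \ B := hmove.left_subset (by simp)
  have hy : y ∈ B \ A := hmove.right_subset (by simp)
  have hne : x ≠ y := by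
    rintro rfl
    exact (Finset.mem_sdiff.1 hx).2 (Finset.mem_sdiff.1 hy).1
  obtain ⟨hT, hanti, hU, hsup, D, hD, hdis⟩ := hmove.connect hAB
  have hcov : ∀ v, ∃ C ∈ (J.tree.connect A B {x} {y}).nodes, v ∈ C := fun v => by
    obtain ⟨C, hC, hv⟩ := J.isJunctionTree.exists_mem_node v
    obtain ⟨E, hE, hCE⟩ := hsup C hC
    exact ⟨E, hE, hCE hv⟩
  have hxU : x ∈ {x} ∪ {y} ∪ A ∩ B := by simp
  have hyU : y ∈ {x} ∪ {y} ∪ A ∩ B := by simp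
  refine ⟨⟨J.tree.connect A B {x} {y}, hT.isJunctionTreeOf hcov hanti⟩, ?_, fun m =>
    ⟨connectProb_pos hmove.link hx hy rfl, disconnectProb_pos hU hxU hyU hne hD hdis⟩⟩
  refine lt_of_le_not_ge (fun u v ⟨huv, C, hC, hu, hv⟩ => ?_) fun hle => ?_
  · obtain ⟨E, hE, hCE⟩ := hsup C hC
    exact ⟨huv, E, hE, hCE hu, hCE hv⟩
  · obtain ⟨-, C, hC, hxC, hyC⟩ := hle (show (J.tree.connect A B {x} {y}).graph.Adj x y from
      ⟨hne, _, hU, hxU, hyU⟩)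
    exact J.isJunctionTree.not_mem_of_mem_sdiff hmove.link hC hx hy hxC hyC

/-- There is only one junction tree without links. -/
theorem eq_of_no_links {J K : JunctionTree V} (hJ : ∀ A B, ¬ J.tree.links.Adj A B)
    (hK : ∀ A B, ¬ K.tree.links.Adj A B) : J = K := by
  have key : ∀ {L : JunctionTree V}, (∀ A B, ¬ L.tree.links.Adj A B) →
      ∃ C : Finset V, L.tree.nodes = {C} ∧ ∀ v, v ∈ C := by
    intro L hL
    have hT := L.isJunctionTree.isIntersectionTree
    obtain ⟨C, hC⟩ := hT.nonempty
    have huniq : ∀ D ∈ L.tree.nodes, D = C := fun D hD => by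
      rcases Relation.ReflTransGen.cases_head (hT.connected D hD C hC trivial trivial) with
        h | ⟨B, hB, -⟩
      · exact h
      · exact absurd hB.1 (hL _ _)
    refine ⟨C, Finset.eq_singleton_iff_unique_mem.2 ⟨hC, huniq⟩, fun v => ?_⟩
    obtain ⟨D, hD, hv⟩ := L.isJunctionTree.exists_mem_node v
    exact huniq D hD ▸ hv
  obtain ⟨C, hC, hCv⟩ := key hJ
  obtain ⟨D, hD, hDv⟩ := key hK
  refine JunctionTree.ext (CliqueTree.ext ?_ ?_)
  · rw [hC, hD, show C = D from Finset.ext fun v => by simp [hCv, hDv]]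
  · ext A B
    simp [hJ, hK]

/-- Climb while a link is left; there are finitely many graphs, so the strict growth of the graph
ends the climb. -/
theorem exists_no_links_reflTransGen {R : JunctionTree V → JunctionTree V → Prop}
    (hR : ∀ J K : JunctionTree V, J.tree.graph < K.tree.graph →
      (∀ m : MoveType, 0 < connectProb m J K ∧ 0 < disconnectProb m K J) → R J K ∧ R K J)
    (J : JunctionTree V) : ∃ Z : JunctionTree V, (∀ A B, ¬ Z.tree.links.Adj A B) ∧
      Relation.ReflTransGen R J Z ∧ Relation.ReflTransGen R Z J := by
  induction hG : J.tree.graph using WellFoundedGT.induction generalizing J with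
  | _ G ih =>
    subst hG
    by_cases h : ∃ A B, J.tree.links.Adj A B
    · obtain ⟨A, B, hAB⟩ := h
      obtain ⟨K, hlt, hprob⟩ := exists_connect hAB
      obtain ⟨Z, hZ, hKZ, hZK⟩ := ih _ hlt K rfl
      obtain ⟨h1, h2⟩ := hR J K hlt hprob
      exact ⟨Z, hZ, hKZ.head h1, hZK.tail h2⟩
    · push Not at h
      exact ⟨J, h, .refl, .refl⟩

/-- A move proposed with positive probability in both directions is accepted with positive
probability. All states therefore communicate with the linkless tree, which has a loop. -/
theorem isPrimitive_transition {w : JunctionTree V → ℝ} (hw : ∀ J, 0 < w J)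
    [Nonempty (JunctionTree V)] (m : MoveType) (a : AcceptRule) {p : ℝ} (hp0 : 0 < p)
    (hp1 : p < 1) : (transition a w (proposal m p)).IsPrimitive := by
  have hq := proposal_nonneg (V := V) (m := m) hp0 hp1
  have hP := transition_mem_rowStochastic (a := a) hw hq (sum_proposal_le_one hp0 hp1)
  have key := exists_no_links_reflTransGen (V := V)
    (R := fun J K => 0 < transition a w (proposal m p) J K) (by
      intro J K hlt hprob
      have hJK : 0 < proposal m p J K :=
        add_pos_of_pos_of_nonneg (mul_pos hp0 (hprob m).1)
          (mul_nonneg (sub_nonneg.2 hp1.le) (disconnectProb_nonneg J K))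
      have hKJ : 0 < proposal m p K J :=
        add_pos_of_nonneg_of_pos (mul_nonneg hp0.le (connectProb_nonneg K J))
          (mul_pos (sub_pos.2 hp1) (hprob m).2)
      have hne : K ≠ J := by
        rintro rfl
        exact lt_irrefl _ hlt
      exact ⟨transition_pos hw hne hJK hKJ, transition_pos hw hne.symm hKJ hJK⟩)
  obtain ⟨Z, hZ, -⟩ := key (Classical.arbitrary _)
  refine isPrimitive_of_communicating hP.1 Z
    (transition_self_pos hw hq (sum_proposal_lt_one hp0 hp1 hZ)) (fun J => ?_) fun J => ?_
  · obtain ⟨Z', hZ', h, -⟩ := key J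
    rwa [eq_of_no_links hZ hZ']
  · obtain ⟨Z', hZ', -, h⟩ := key J
    rwa [eq_of_no_links hZ hZ']

end Irreducibility

end JTSampler

/-! ### The main theorem. -/

open JTSampler in
theorem mainTheorem3 {V : Type*} [Fintype V] [DecidableEq V]
    (π : SimpleGraph V → ℝ)
    (hπ_pos : ∀ G, IsDecomposable G → 0 < π G)
    (hπ_zero : ∀ G, ¬ IsDecomposable G → π G = 0)
    (hπ_sum : ∑ G, π G = 1)
    (p : ℝ) (hp0 : 0 < p) (hp1 : p < 1) (m : MoveType) (a : AcceptRule) :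
    -- the target is a strictly positive probability distribution on junction trees
    ((∀ J : JunctionTree V, 0 < target π J) ∧ ∑ J : JunctionTree V, target π J = 1) ∧
    -- the sampler is a Markov chain, reversible with respect to the target
    samplerMatrix m a p π ∈ Matrix.rowStochastic ℝ (JunctionTree V) ∧
    (∀ J K : JunctionTree V,
      target π J * samplerMatrix m a p π J K = target π K * samplerMatrix m a p π K J) ∧
    Matrix.vecMul (target π) (samplerMatrix m a p π) = target π ∧
    -- it is irreducible
    (samplerMatrix m a p π).IsIrreducible ∧
    -- it is ergodic: its law converges to the target, and so do the ergodic averages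
    (∀ J K : JunctionTree V,
      Filter.Tendsto (fun n : ℕ => (samplerMatrix m a p π ^ n) J K) Filter.atTop
        (nhds (target π K))) ∧
    (∀ (Ω : Type*) [MeasurableSpace Ω] (ℙ : MeasureTheory.Measure Ω)
      [MeasureTheory.IsProbabilityMeasure ℙ] (Z : ℕ → Ω → JunctionTree V),
      IsMarkovChain (samplerMatrix m a p π) ℙ Z → ∀ f : JunctionTree V → ℝ,
        ∀ᵐ ω ∂ℙ, Filter.Tendsto
          (fun n : ℕ => (∑ k ∈ Finset.range n, f (Z k ω)) / (n : ℝ)) Filter.atTop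
          (nhds (∑ J : JunctionTree V, target π J * f J))) := by
  have hw := target_pos hπ_pos
  have hw1 : ∑ J : JunctionTree V, target π J = 1 := (sum_target hπ_zero).trans hπ_sum
  -- An empty state space would make the total mass 0 instead of 1.
  have hne : Nonempty (JunctionTree V) := by
    by_contra h
    rw [not_nonempty_iff] at h
    simp at hw1
  have hq := proposal_nonneg (V := V) (m := m) hp0 hp1
  have hP : samplerMatrix m a p π ∈ Matrix.rowStochastic ℝ (JunctionTree V) :=
    transition_mem_rowStochastic hw hq (sum_proposal_le_one hp0 hp1)
  have hrev : ∀ J K : JunctionTree V,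
      target π J * samplerMatrix m a p π J K = target π K * samplerMatrix m a p π K J :=
    transition_reversible hw hq
  have hst := vecMul_eq_of_reversible hP hrev
  have hprim : (samplerMatrix m a p π).IsPrimitive := isPrimitive_transition hw m a hp0 hp1
  have hlim := tendsto_pow_of_isPrimitive hP hprim hw hw1 hst
  exact ⟨⟨hw, hw1⟩, hP, hrev, hst, hprim.isIrreducible, hlim,
    fun Ω _ ℙ _ Z hZ f => hZ.ae_tendsto_average hst hw1 hlim f⟩
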